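/- Let $E$ be a real Banach space that is 2-uniformly convex (its modulus of convexity $\delta_E(\varepsilon)=\inf\{1-\|\tfrac{x+y}{2}\| : \|x\|,\|y\|\le 1,\ \|x-y\|\ge\varepsilon\}$ satisfies $\delta_E(\varepsilon)\ge c\varepsilon^2$ on $[0,2]$ for some $c>0$) and uniformly smooth (the limit $\lim_{t\to0}(\|x+ty\|-\|x\|)/t$ exists uniformly for $x,y$ in the unit sphere). Let $J:E\to E^*$ be the normalized duality mapping, $\langle Jx,x\rangle=\|Jx\|^2=\|x\|^2$ (it is single-valued and bijective here), and let $\phi(x,y)=\|x\|^2-2\langle Jy,x\rangle+\|y\|^2$. For a closed convex nonempty $C\subseteq E$, the generalized projection $\Pi_C(x)$ is the unique minimizer of $y\mapsto\phi(y,x)$ over $C$. Let $B:E\to2^{E^*}$ be maximal monotone, let $A:E\to E^*$ be monotone and $L$-Lipschitz continuous with $L>0$, and suppose that $(A+B)^{-1}(0)=\{x : 0\in Ax+Bx\}$ is nonempty. For $r>0$ let $J_r^B=(J+rB)^{-1}J$ be the resolvent of $B$. Let $\mu\ge1$ be the 2-uniform convexity constant of $E$, that is, the least $\mu\ge 1$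 with $\tfrac12(\|x+y\|^2+\|x-y\|^2)\ge\|x\|^2+\|\mu^{-1}y\|^2$ for all $x,y\in E$. Let $\kappa$ be the 2-uniform smoothness constant of $E^*$, that is, the least $\kappa>0$ with $\|f+g\|^2\le\|f\|^2+2\langle J_*f,g\rangle+2\kappa^2\|g\|^2$ for all $f,g\in E^*$, where $J_*$ is the normalized duality mapping of $E^*$ (if $E=\{0\}$, put $\kappa=0$). Let $(\lambda_n)_{n\ge1}$ be real numbers with $$0<a\le\lambda_n\le b \quad (n\ge1),\qquad \sqrt2\,\mu\,\kappa\,L\,b<1,$$ and let $(\alpha_n)_{n\ge1}$ be a sequence in $(0,1)$. Given $x_1\in E$, define for $n\ge1$ $$y_n=J_{\lambda_n}^B J^{-1}(Jx_n-\lambda_nAx_n),\qquad w_n=J^{-1}\big[Jy_n-\lambda_n(Ay_n-Ax_n)\big],\qquad x_{n+1}=J^{-1}\big[\alpha_nJx_1+(1-\alpha_n)Jw_n\big].$$ **Theorem.** If $\lim_{n\to\infty}\alpha_n=0$ and $\sum_{n=1}^\infty\alpha_n=\infty$, then $(x_n)$ converges strongly to $z=\Pi_{(A+B)^{-1}(0)}(x_1)$.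 -/

import Mathlib

open Filter Topology

noncomputable section

namespace BanachTseng

variable {E : Type*} [NormedAddCommGroup E] [NormedSpace ℝ E]

/-- The modulus of convexity `δ_E(ε)`, the infimum of `1 - ‖(x + y) / 2‖` over `x, y` in the closed
unit ball with `‖x - y‖ ≥ ε`. It takes values in the extended reals, so that the infimum of the
empty set (which occurs only in the zero space) is `+∞`. -/
def modulusOfConvexity (E : Type*) [NormedAddCommGroup E] [NormedSpace ℝ E] (ε : ℝ) : EReal :=
  ⨅ (x : E) (y : E) (_ : ‖x‖ ≤ 1) (_ : ‖y‖ ≤ 1) (_ : ε ≤ ‖x - y‖),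
    ((1 - ‖(1 / 2 : ℝ) • (x + y)‖ : ℝ) : EReal)

/-- `E` is 2-uniformly convex: `δ_E(ε) ≥ c ε²` on `[0, 2]` for some `c > 0`. -/
def TwoUniformlyConvex (E : Type*) [NormedAddCommGroup E] [NormedSpace ℝ E] : Prop :=
  ∃ c : ℝ, 0 < c ∧ ∀ ε ∈ Set.Icc (0 : ℝ) 2, ((c * ε ^ 2 : ℝ) : EReal) ≤ modulusOfConvexity E ε

/-- `E` is uniformly smooth: the limit of `(‖x + t y‖ - ‖x‖) / t` as `t → 0`, `t ≠ 0`, exists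
uniformly in `x, y` in the unit sphere. -/
def UniformlySmooth (E : Type*) [NormedAddCommGroup E] [NormedSpace ℝ E] : Prop :=
  ∃ g : E × E → ℝ, TendstoUniformlyOn
    (fun (t : ℝ) (p : E × E) => (‖p.1 + t • p.2‖ - ‖p.1‖) / t) g (𝓝[≠] 0)
    (Metric.sphere 0 1 ×ˢ Metric.sphere 0 1)

/-- The values `f` of the (set-valued) normalized duality mapping at `x`:
`⟨f, x⟩ = ‖f‖² = ‖x‖²`. -/
def dualitySet (x : E) : Set (StrongDual ℝ E) :=
  {f | f x = ‖f‖ ^ 2 ∧ ‖f‖ ^ 2 = ‖x‖ ^ 2}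

theorem dualitySet_nonempty (x : E) : (dualitySet x).Nonempty := by
  obtain ⟨g, hg, hgx⟩ := exists_dual_vector'' ℝ x
  have hgx' : g x = ‖x‖ := by simpa using hgx
  rcases eq_or_ne x 0 with rfl | hx
  · exact ⟨0, by simp [dualitySet]⟩
  · have hx' : 0 < ‖x‖ := norm_pos_iff.mpr hx
    have h1 : ‖g‖ = 1 := by
      refine le_antisymm hg ?_
      have h := g.le_opNorm x
      rw [hgx', Real.norm_eq_abs, abs_of_pos hx'] at h
      nlinarith
    refine ⟨‖x‖ • g, ?_⟩
    have h2 : ‖‖x‖ • g‖ = ‖x‖ := by rw [norm_smul, h1, norm_norm, mul_one]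
    refine ⟨?_, by rw [h2]⟩
    rw [h2, smul_apply, hgx', smul_eq_mul, sq]

/-- The normalized duality mapping `J : E → E*` as a single-valued mapping. `dualitySet x` is never
empty, and it has exactly one element when `E` is smooth. -/
def dualityMap (x : E) : StrongDual ℝ E :=
  (dualitySet_nonempty x).choose

theorem dualityMap_mem (x : E) : dualityMap x ∈ dualitySet x :=
  (dualitySet_nonempty x).choose_spec

/-- The inverse `J⁻¹ : E* → E` of the normalized duality mapping. `J` is a bijection when `E` is
uniformly convex, uniformly smooth and complete. -/
def dualityInv (f : StrongDual ℝ E) : E :=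
  Function.invFun (dualityMap (E := E)) f

/-- The functional `φ(x, y) = ‖x‖² - 2⟨x, Jy⟩ + ‖y‖²`. -/
def lyapunov (x y : E) : ℝ :=
  ‖x‖ ^ 2 - 2 * dualityMap y x + ‖y‖ ^ 2

/-- `z` is a generalized projection of `x` onto `C`: a minimizer of `φ(·, x)` over `C`. -/
def IsGeneralizedProjection (C : Set E) (x z : E) : Prop :=
  z ∈ C ∧ ∀ y ∈ C, lyapunov z x ≤ lyapunov y x

/-- The 2-uniform convexity constant of `E`: the least `m ≥ 1` such that
`(‖x + y‖² + ‖x - y‖²) / 2 ≥ ‖x‖² + ‖m⁻¹ y‖²` for all `x, y`. -/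
def uniformConvexityConst (E : Type*) [NormedAddCommGroup E] [NormedSpace ℝ E] : ℝ :=
  sInf {m : ℝ | 1 ≤ m ∧ ∀ x y : E,
    ‖x‖ ^ 2 + ‖m⁻¹ • y‖ ^ 2 ≤ (‖x + y‖ ^ 2 + ‖x - y‖ ^ 2) / 2}

/-- The 2-uniform smoothness constant of `F`: the least `k > 0` such that
`‖x + y‖² ≤ ‖x‖² + 2⟨y, Jx⟩ + 2 k² ‖y‖²` for all `x, y` (and `0` if `F` is the zero space). -/
def uniformSmoothnessConst (F : Type*) [NormedAddCommGroup F] [NormedSpace ℝ F] : ℝ :=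
  sInf {k : ℝ | 0 < k ∧ ∀ x y : F,
    ‖x + y‖ ^ 2 ≤ ‖x‖ ^ 2 + 2 * dualityMap x y + 2 * k ^ 2 * ‖y‖ ^ 2}

/-- Monotonicity of a set-valued operator. -/
def IsMonotoneOperator (B : E → Set (StrongDual ℝ E)) : Prop :=
  ∀ x y : E, ∀ f ∈ B x, ∀ g ∈ B y, 0 ≤ (f - g) (x - y)

/-- Maximal monotonicity of a set-valued operator: its graph is not contained in that of another
monotone operator. -/
def IsMaximalMonotone (B : E → Set (StrongDual ℝ E)) : Prop :=
  IsMonotoneOperator B ∧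
    ∀ S : E → Set (StrongDual ℝ E), IsMonotoneOperator S → (∀ x, B x ⊆ S x) → B = S

/-- The solution set `(A + B)⁻¹(0)` of `0 ∈ Ax + Bx`. -/
def solutionSet (A : E → StrongDual ℝ E) (B : E → Set (StrongDual ℝ E)) : Set E :=
  {x | ∃ v ∈ B x, A x + v = 0}

/-- The resolvent `(J + rB)⁻¹ J` of `B`: the point `z` with `Jx ∈ Jz + r Bz`. For `r > 0` there is
exactly one such `z` when `B` is maximal monotone and `E` is reflexive, strictly convex and
smooth. -/
def resolvent (B : E → Set (StrongDual ℝ E)) (r : ℝ) (x : E) : E :=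
  Classical.epsilon fun z : E => ∃ v ∈ B z, dualityMap x = dualityMap z + r • v

end BanachTseng

end

/-!
2-uniform convexity makes `‖·‖²` strongly convex with constant `c = μ⁻²`. Consequently every
functional is a value of `J`, the space is reflexive, the dual norm is 2-smooth, and
`c ‖x - y‖² ≤ φ(x, y)`. Let `z` be a zero of `A + B` and `q = √2 μ κ L b < 1`. The 2-smoothness of
the dual norm bounds the error of the forward correction by `q² φ(yₙ, xₙ)`, so that
`φ(z, wₙ) ≤ φ(z, xₙ) - (1 - q²) φ(yₙ, xₙ)`. For `z = Π(x₁)`, the anchoring step turns this into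
`φ(z, xₙ₊₁) ≤ (1 - αₙ) φ(z, xₙ) + αₙ βₙ`, and by Xu's lemma it suffices that `limsup βₙ ≤ 0`.
Here `βₙ` is the anchoring error `2 ⟨Jx₁ - Jz, xₙ₊₁ - z⟩` diminished by
`(1 - αₙ) (1 - q²) φ(yₙ, xₙ) / αₙ`. Along an ultrafilter that keeps `βₙ` above some `ε > 0`,
`φ(yₙ, xₙ)` therefore tends to zero, so the weak limit of `xₙ₊₁` is a zero of `A + B`, at which the
variational inequality of the generalized projection makes the anchoring error nonpositive.
-/

namespace BanachTseng

section Duality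

variable {V : Type*} [NormedAddCommGroup V] [NormedSpace ℝ V] {f : StrongDual ℝ V} {x : V}

theorem apply_le_norm_mul_norm (f : StrongDual ℝ V) (x : V) : f x ≤ ‖f‖ * ‖x‖ :=
  (le_abs_self _).trans (f.le_opNorm x)

theorem two_mul_apply_le (f : StrongDual ℝ V) (x : V) : 2 * f x ≤ ‖f‖ ^ 2 + ‖x‖ ^ 2 := by
  linarith [apply_le_norm_mul_norm f x, two_mul_le_add_sq ‖f‖ ‖x‖]

theorem norm_sq_le_of_forall_two_mul_apply_le {a K : ℝ} (ha : 0 ≤ a)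
    (h : ∀ z, 2 * f z ≤ a * ‖z‖ ^ 2 + K) : ‖f‖ ^ 2 ≤ a * K := by
  have hK : 0 ≤ K := by simpa using h 0
  have hsq : ∀ z, f z ^ 2 ≤ a * K * ‖z‖ ^ 2 := by
    intro z
    have hd : discrim (a * ‖z‖ ^ 2) (-(2 * f z)) K ≤ 0 := discrim_le_zero fun t => by
      have ht := h (t • z)
      rw [map_smul, smul_eq_mul, norm_smul, mul_pow, Real.norm_eq_abs, sq_abs] at ht
      linarith
    rw [discrim] at hd
    linarith
  refine (Real.le_sqrt (norm_nonneg f) (by positivity)).mp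
    (f.opNorm_le_bound (Real.sqrt_nonneg _) fun z => ?_)
  rw [← Real.sqrt_sq (norm_nonneg z), ← Real.sqrt_mul (by positivity)]
  exact Real.abs_le_sqrt (hsq z)

theorem mem_dualitySet_iff_norm_sq_add_norm_sq_le :
    f ∈ dualitySet x ↔ ‖f‖ ^ 2 + ‖x‖ ^ 2 ≤ 2 * f x := by
  refine ⟨fun ⟨hfx, hnorm⟩ => by linarith, fun h => ?_⟩
  have hle := apply_le_norm_mul_norm f x
  have hnorm : ‖f‖ = ‖x‖ := by
    have : (‖f‖ - ‖x‖) ^ 2 = 0 := le_antisymm (by linarith) (sq_nonneg _)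
    exact sub_eq_zero.mp (pow_eq_zero_iff two_ne_zero |>.mp this)
  rw [hnorm] at h hle
  exact ⟨by rw [hnorm]; linarith, by rw [hnorm]⟩

theorem norm_of_mem_dualitySet (h : f ∈ dualitySet x) : ‖f‖ = ‖x‖ :=
  (sq_eq_sq₀ (norm_nonneg _) (norm_nonneg _)).mp h.2

theorem apply_self_of_mem_dualitySet (h : f ∈ dualitySet x) : f x = ‖x‖ ^ 2 :=
  h.1.trans h.2

theorem norm_dualityMap (x : V) : ‖dualityMap x‖ = ‖x‖ :=
  norm_of_mem_dualitySet (dualityMap_mem x)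

theorem dualityMap_self (x : V) : dualityMap x x = ‖x‖ ^ 2 :=
  apply_self_of_mem_dualitySet (dualityMap_mem x)

theorem smul_mem_dualitySet (h : f ∈ dualitySet x) (t : ℝ) : t • f ∈ dualitySet (t • x) := by
  refine ⟨?_, by rw [norm_smul, norm_smul, norm_of_mem_dualitySet h]⟩
  rw [norm_smul, mul_pow, Real.norm_eq_abs, sq_abs, smul_apply, map_smul, h.1]
  simp only [smul_eq_mul]
  ring

theorem subgradient_of_mem_dualitySet (h : f ∈ dualitySet x) (y : V) :
    ‖x‖ ^ 2 + 2 * f y ≤ ‖x + y‖ ^ 2 := by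
  have hxy := two_mul_apply_le f (x + y)
  rw [map_add, apply_self_of_mem_dualitySet h, h.2] at hxy
  linarith

theorem mem_dualitySet_of_forall_le (h : ∀ y, ‖x‖ ^ 2 - 2 * f x ≤ ‖y‖ ^ 2 - 2 * f y) :
    f ∈ dualitySet x := by
  have hf : ‖f‖ ^ 2 ≤ 1 * (2 * f x - ‖x‖ ^ 2) :=
    norm_sq_le_of_forall_two_mul_apply_le zero_le_one fun y => by linarith [h y]
  exact mem_dualitySet_iff_norm_sq_add_norm_sq_le.mpr (by linarith)

theorem eq_of_forall_apply_le_add {f g : StrongDual ℝ V} {a : ℝ} (ha : 0 ≤ a)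
    (h : ∀ z, 2 * f z ≤ 2 * g z + a * ‖z‖ ^ 2) : f = g := by
  have hfg : ‖f - g‖ ^ 2 ≤ a * 0 :=
    norm_sq_le_of_forall_two_mul_apply_le ha fun z => by rw [sub_apply]; linarith [h z]
  rw [mul_zero] at hfg
  exact sub_eq_zero.mp (norm_eq_zero.mp (pow_eq_zero_iff two_ne_zero |>.mp
    (le_antisymm hfg (sq_nonneg _))))

end Duality

section StrongConvexity

/-- Strong convexity of the square of the norm with constant `c`, in the form of a parallelogram
inequality. For `c = μ⁻²` this is the inequality defining the 2-uniform convexity constant `μ`. -/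
def StronglyConvexSq (E : Type*) [NormedAddCommGroup E] (c : ℝ) : Prop :=
  ∀ x y : E, ‖x‖ ^ 2 + c * ‖y‖ ^ 2 ≤ (‖x + y‖ ^ 2 + ‖x - y‖ ^ 2) / 2

variable {E : Type*} [NormedAddCommGroup E] [NormedSpace ℝ E] {c : ℝ} {x y : E}
  {f g : StrongDual ℝ E}

theorem stronglyConvexSq_iff_midpoint : StronglyConvexSq E c ↔ ∀ x y : E,
    ‖(1 / 2 : ℝ) • (x + y)‖ ^ 2 + c / 4 * ‖x - y‖ ^ 2 ≤ (‖x‖ ^ 2 + ‖y‖ ^ 2) / 2 := by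
  constructor <;> intro h x y
  · have hxy := h ((1 / 2 : ℝ) • (x + y)) ((1 / 2 : ℝ) • (x - y))
    rw [show (1 / 2 : ℝ) • (x + y) + (1 / 2 : ℝ) • (x - y) = x by module,
      show (1 / 2 : ℝ) • (x + y) - (1 / 2 : ℝ) • (x - y) = y by module,
      norm_smul _ (x - y), mul_pow] at hxy
    norm_num at hxy ⊢
    linarith
  · have hxy := h (x + y) (x - y)
    rw [show (1 / 2 : ℝ) • (x + y + (x - y)) = x by module,
      show x + y - (x - y) = (2 : ℝ) • y by module, norm_smul, mul_pow] at hxy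
    norm_num at hxy
    linarith

theorem StronglyConvexSq.subgradient (hc : StronglyConvexSq E c) (h : f ∈ dualitySet x) (y : E) :
    ‖x‖ ^ 2 + 2 * f y + c * ‖y‖ ^ 2 ≤ ‖x + y‖ ^ 2 := by
  have dyadic : ∀ (n : ℕ) (y : E),
      c * (1 - (1 / 2) ^ n) * ‖y‖ ^ 2 ≤ ‖x + y‖ ^ 2 - ‖x‖ ^ 2 - 2 * f y := by
    intro n
    induction n with
    | zero =>
      intro y
      rw [pow_zero, sub_self, mul_zero, zero_mul]
      linarith [subgradient_of_mem_dualitySet h y]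
    | succ n ih =>
      intro y
      have hhalf := ih ((1 / 2 : ℝ) • y)
      have hmid := stronglyConvexSq_iff_midpoint.mp hc (x + y) x
      rw [show (1 / 2 : ℝ) • (x + y + x) = x + (1 / 2 : ℝ) • y by module,
        add_sub_cancel_left] at hmid
      rw [norm_smul, mul_pow, map_smul, smul_eq_mul] at hhalf
      norm_num at hhalf hmid
      rw [pow_succ]
      linarith
  have hlim : Tendsto (fun n : ℕ => c * (1 - (1 / 2 : ℝ) ^ n) * ‖y‖ ^ 2) atTop
      (𝓝 (c * (1 - 0) * ‖y‖ ^ 2)) :=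
    ((tendsto_const_nhds.sub (tendsto_pow_atTop_nhds_zero_of_lt_one (by norm_num)
      (by norm_num))).const_mul c).mul_const _
  linarith [le_of_tendsto' hlim fun n => dyadic n y]

theorem StronglyConvexSq.mul_norm_sub_sq_le (hc : StronglyConvexSq E c) (hf : f ∈ dualitySet x)
    (hg : g ∈ dualitySet y) : c * ‖x - y‖ ^ 2 ≤ (f - g) (x - y) := by
  have hx := hc.subgradient hf (y - x)
  have hy := hc.subgradient hg (x - y)
  rw [add_sub_cancel, norm_sub_rev, ← neg_sub x y, map_neg] at hx
  rw [add_sub_cancel] at hy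
  rw [sub_apply]
  linarith

theorem StronglyConvexSq.mul_norm_sub_le (hc : StronglyConvexSq E c) (hf : f ∈ dualitySet x)
    (hg : g ∈ dualitySet y) : c * ‖x - y‖ ≤ ‖f - g‖ := by
  rcases (norm_nonneg (x - y)).eq_or_lt with h | h
  · rw [← h, mul_zero]
    exact norm_nonneg _
  · refine le_of_mul_le_mul_right ?_ h
    calc c * ‖x - y‖ * ‖x - y‖ = c * ‖x - y‖ ^ 2 := by ring
      _ ≤ (f - g) (x - y) := hc.mul_norm_sub_sq_le hf hg
      _ ≤ ‖f - g‖ * ‖x - y‖ := apply_le_norm_mul_norm _ _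

/-- Conjugation exchanges strong convexity of the norm and strong smoothness of the dual norm. -/
theorem StronglyConvexSq.norm_add_sq_le_dual (hc : StronglyConvexSq E c) (hc₀ : 0 < c)
    (hf : f ∈ dualitySet x) (g : StrongDual ℝ E) :
    ‖f + g‖ ^ 2 ≤ ‖f‖ ^ 2 + 2 * g x + c⁻¹ * ‖g‖ ^ 2 := by
  have h : ‖f + g‖ ^ 2 ≤ 1 * (‖f‖ ^ 2 + 2 * g x + c⁻¹ * ‖g‖ ^ 2) := by
    refine norm_sq_le_of_forall_two_mul_apply_le zero_le_one fun z => ?_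
    have hz := hc.subgradient hf (z - x)
    have hg : 2 * g (z - x) ≤ c⁻¹ * ‖g‖ ^ 2 + c * ‖z - x‖ ^ 2 := by
      have hsq : c⁻¹ * ‖g‖ ^ 2 + c * ‖z - x‖ ^ 2 - 2 * (‖g‖ * ‖z - x‖) =
          c⁻¹ * (‖g‖ - c * ‖z - x‖) ^ 2 := by
        field_simp
        ring
      have : 0 ≤ c⁻¹ * (‖g‖ - c * ‖z - x‖) ^ 2 := by positivity
      linarith [apply_le_norm_mul_norm g (z - x)]
    rw [add_sub_cancel, map_sub, apply_self_of_mem_dualitySet hf, ← hf.2] at hz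
    rw [map_sub] at hg
    rw [add_apply]
    linarith
  rwa [one_mul] at h

theorem StronglyConvexSq.bidual_eq_inclusion (hc : StronglyConvexSq E c) (hc₀ : 0 < c)
    (hf : f ∈ dualitySet x) {F : StrongDual ℝ (StrongDual ℝ E)} (hF : F ∈ dualitySet f) :
    F = NormedSpace.inclusionInDoubleDual ℝ E x :=
  eq_of_forall_apply_le_add (inv_nonneg.mpr hc₀.le) fun g => by
    rw [NormedSpace.dual_def]
    linarith [subgradient_of_mem_dualitySet hF g, hc.norm_add_sq_le_dual hc₀ hf g]

end StrongConvexity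

section Reflexivity

theorem exists_forall_add_dist_sq_le {α : Type*} [PseudoMetricSpace α] [CompleteSpace α]
    {C : Set α} (hne : C.Nonempty) (hcl : IsClosed C) {q : α → ℝ} (hq : ContinuousOn q C)
    (hbdd : BddBelow (q '' C)) {k : ℝ} (hk : 0 < k)
    (hmid : ∀ u ∈ C, ∀ v ∈ C, ∃ m ∈ C, q m + k * dist u v ^ 2 ≤ (q u + q v) / 2) :
    ∃ x ∈ C, ∀ y ∈ C, q x + 2 * k * dist x y ^ 2 ≤ q y := by
  have hpar : ∀ u ∈ C, ∀ v ∈ C, sInf (q '' C) + k * dist u v ^ 2 ≤ (q u + q v) / 2 := by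
    intro u hu v hv
    obtain ⟨m, hm, h⟩ := hmid u hu v hv
    linarith [csInf_le hbdd ⟨m, hm, rfl⟩]
  obtain ⟨a, ha_anti, ha_lim, ha_mem⟩ := exists_seq_tendsto_sInf (hne.image q) hbdd
  choose u huC hua using ha_mem
  have hcau : CauchySeq u := by
    refine cauchySeq_of_le_tendsto_0 (fun N => √((a N - sInf (q '' C)) / k)) ?_ ?_
    · intro n m N hn hm
      refine Real.le_sqrt_of_sq_le ((le_div_iff₀ hk).mpr ?_)
      have h := hpar _ (huC n) _ (huC m)
      rw [hua, hua] at h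
      linarith [ha_anti hn, ha_anti hm]
    · have h : Tendsto (fun N => √((a N - sInf (q '' C)) / k)) atTop (𝓝 √0) :=
        (Real.continuous_sqrt.tendsto _).comp
          (by simpa using (ha_lim.sub_const (sInf (q '' C))).div_const k)
      rwa [Real.sqrt_zero] at h
  obtain ⟨x, hx⟩ := cauchySeq_tendsto_of_complete hcau
  have hxC : x ∈ C := hcl.mem_of_tendsto hx (Eventually.of_forall huC)
  have hqx : q x = sInf (q '' C) := by
    refine tendsto_nhds_unique ((hq x hxC).tendsto.comp
      (tendsto_nhdsWithin_iff.mpr ⟨hx, Eventually.of_forall huC⟩)) ?_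
    simpa only [Function.comp_def, hua] using ha_lim
  exact ⟨x, hxC, fun y hy => by linarith [hpar x hxC y hy]⟩

variable {E : Type*} [NormedAddCommGroup E] [NormedSpace ℝ E] {c : ℝ}

theorem StronglyConvexSq.exists_minimizer [CompleteSpace E] (hc : StronglyConvexSq E c)
    (hc₀ : 0 < c) {C : Set E} (hne : C.Nonempty) (hcl : IsClosed C) (hcv : Convex ℝ C)
    (f : StrongDual ℝ E) :
    ∃ x ∈ C, ∀ y ∈ C, ‖x‖ ^ 2 - 2 * f x + c / 2 * ‖x - y‖ ^ 2 ≤ ‖y‖ ^ 2 - 2 * f y := by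
  have hbdd : BddBelow ((fun y => ‖y‖ ^ 2 - 2 * f y) '' C) := by
    refine ⟨-‖f‖ ^ 2, ?_⟩
    rintro _ ⟨y, -, rfl⟩
    linarith [two_mul_apply_le f y]
  obtain ⟨x, hxC, hx⟩ := exists_forall_add_dist_sq_le hne hcl (by fun_prop) hbdd
    (by positivity : 0 < c / 4) fun u hu v hv => by
      refine ⟨(1 / 2 : ℝ) • (u + v), ?_, ?_⟩
      · rw [smul_add]
        exact hcv hu hv (by norm_num) (by norm_num) (by norm_num)
      · have := stronglyConvexSq_iff_midpoint.mp hc u v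
        rw [map_smul, map_add, smul_eq_mul, dist_eq_norm]
        linarith
  refine ⟨x, hxC, fun y hy => ?_⟩
  have := hx y hy
  rw [dist_eq_norm] at this
  linarith

theorem StronglyConvexSq.exists_mem_dualitySet [CompleteSpace E] (hc : StronglyConvexSq E c)
    (hc₀ : 0 < c) (f : StrongDual ℝ E) : ∃ x, f ∈ dualitySet x := by
  obtain ⟨x, -, hx⟩ := hc.exists_minimizer hc₀ Set.univ_nonempty isClosed_univ convex_univ f
  refine ⟨x, mem_dualitySet_of_forall_le fun y => ?_⟩
  have : 0 ≤ c / 2 * ‖x - y‖ ^ 2 := by positivity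
  linarith [hx y (Set.mem_univ y)]

/-- If `f` minimizes `‖f‖² - 2 F f` up to `ε` and `f ∈ J x`, then strong smoothness of the dual norm
at `f`, where its gradient is `2 x`, forces `F` to be close to `x`. -/
theorem StronglyConvexSq.exists_norm_sub_inclusion_sq_le [CompleteSpace E]
    (hc : StronglyConvexSq E c) (hc₀ : 0 < c) (F : StrongDual ℝ (StrongDual ℝ E)) {ε : ℝ}
    (hε : 0 < ε) : ∃ x, ‖F - NormedSpace.inclusionInDoubleDual ℝ E x‖ ^ 2 ≤ c⁻¹ * ε := by
  have hbdd : BddBelow (Set.range fun f => ‖f‖ ^ 2 - 2 * F f) := by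
    refine ⟨-‖F‖ ^ 2, ?_⟩
    rintro _ ⟨f, rfl⟩
    linarith [two_mul_apply_le F f]
  obtain ⟨_, ⟨f, rfl⟩, hf⟩ := exists_lt_of_csInf_lt (Set.range_nonempty _)
    (lt_add_of_pos_right (sInf (Set.range fun f => ‖f‖ ^ 2 - 2 * F f)) hε)
  obtain ⟨x, hx⟩ := hc.exists_mem_dualitySet hc₀ f
  refine ⟨x, norm_sq_le_of_forall_two_mul_apply_le (inv_nonneg.mpr hc₀.le) fun g => ?_⟩
  have hmin := csInf_le hbdd ⟨f + g, rfl⟩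
  have hsmooth := hc.norm_add_sq_le_dual hc₀ hx g
  simp only [map_add] at hmin
  rw [sub_apply, NormedSpace.dual_def]
  linarith

theorem StronglyConvexSq.surjective_inclusionInDoubleDual [CompleteSpace E]
    (hc : StronglyConvexSq E c) (hc₀ : 0 < c) :
    Function.Surjective (NormedSpace.inclusionInDoubleDual ℝ E) := by
  intro F
  have hclosed : IsClosed (Set.range (NormedSpace.inclusionInDoubleDualLi ℝ (E := E))) :=
    (NormedSpace.inclusionInDoubleDualLi ℝ (E := E)).isometry.isUniformInducing.isComplete_range
      |>.isClosed
  have happrox : ∀ ε > 0, ∃ G ∈ Set.range (NormedSpace.inclusionInDoubleDualLi ℝ (E := E)),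
      dist F G < ε := by
    intro ε hε
    obtain ⟨x, hx⟩ := hc.exists_norm_sub_inclusion_sq_le hc₀ F
      (by positivity : 0 < c * (ε / 2) ^ 2)
    rw [inv_mul_cancel_left₀ hc₀.ne'] at hx
    refine ⟨_, ⟨x, rfl⟩, (dist_eq_norm F _).trans_lt ?_⟩
    exact (le_of_sq_le_sq hx (by positivity)).trans_lt (half_lt_self hε)
  have hF := Metric.mem_closure_iff.mpr happrox
  rwa [hclosed.closure_eq] at hF

end Reflexivity

section Constants

variable {E : Type*} [NormedAddCommGroup E] [NormedSpace ℝ E]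

theorem TwoUniformlyConvex.exists_modulus (h : TwoUniformlyConvex E) :
    ∃ c : ℝ, 0 < c ∧ ∀ x y : E, ‖x‖ ≤ 1 → ‖y‖ ≤ 1 →
      c * ‖x - y‖ ^ 2 ≤ 1 - ‖(1 / 2 : ℝ) • (x + y)‖ := by
  obtain ⟨c, hc, h⟩ := h
  refine ⟨c, hc, fun x y hx hy => ?_⟩
  have hδ := h ‖x - y‖ ⟨norm_nonneg _, (norm_sub_le x y).trans (by linarith)⟩
  have hle : modulusOfConvexity E ‖x - y‖ ≤ ((1 - ‖(1 / 2 : ℝ) • (x + y)‖ : ℝ) : EReal) :=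
    iInf₂_le_of_le x y (iInf₂_le_of_le hx hy (iInf_le _ le_rfl))
  exact EReal.coe_le_coe_iff.mp (hδ.trans hle)

/-- Write `(x + s y) / 2 = s (x + y) / 2 + (1 - s) x / 2` and `x - s y = (1 - s) x + s (x - y)`. -/
theorem midpoint_smul_sq_le {c : ℝ} (hc : 0 ≤ c) (hc' : c ≤ 1 / 4) {x y : E} (hx : ‖x‖ ≤ 1)
    (hxy : c * ‖x - y‖ ^ 2 ≤ 1 - ‖(1 / 2 : ℝ) • (x + y)‖) {s : ℝ} (hs₀ : 0 ≤ s) (hs₁ : s ≤ 1) :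
    ‖(1 / 2 : ℝ) • (x + s • y)‖ ^ 2 + c / 2 * ‖x - s • y‖ ^ 2 ≤ (1 + s ^ 2) / 2 := by
  set d := ‖x - y‖
  have hd₁ : c * d ^ 2 ≤ 1 := hxy.trans (by linarith [norm_nonneg ((1 / 2 : ℝ) • (x + y))])
  have hmid : ‖(1 / 2 : ℝ) • (x + s • y)‖ ≤ (1 + s) / 2 - s * (c * d ^ 2) := by
    calc ‖(1 / 2 : ℝ) • (x + s • y)‖ = ‖s • ((1 / 2 : ℝ) • (x + y)) + ((1 - s) / 2) • x‖ := by
          congr 1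
          module
      _ ≤ s * ‖(1 / 2 : ℝ) • (x + y)‖ + (1 - s) / 2 * ‖x‖ :=
        norm_add_le_of_le (norm_smul_of_nonneg hs₀ _).le (norm_smul_of_nonneg (by linarith) _).le
      _ ≤ s * (1 - c * d ^ 2) + (1 - s) / 2 * 1 := by gcongr; linarith
      _ = _ := by ring
  have hdiff : ‖x - s • y‖ ≤ (1 - s) + s * d := by
    calc ‖x - s • y‖ = ‖(1 - s) • x + s • (x - y)‖ := by
          congr 1
          module
      _ ≤ (1 - s) * ‖x‖ + s * d :=
        norm_add_le_of_le (norm_smul_of_nonneg (by linarith) _).le (norm_smul_of_nonneg hs₀ _).le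
      _ ≤ (1 - s) * 1 + s * d := by gcongr
      _ = _ := by ring
  have hdiff_sq : c / 2 * ‖x - s • y‖ ^ 2 ≤ (1 - s) ^ 2 / 4 + s ^ 2 * (c * d ^ 2) := by
    calc c / 2 * ‖x - s • y‖ ^ 2 ≤ c / 2 * ((1 - s) + s * d) ^ 2 := by gcongr
      _ ≤ c / 2 * (2 * ((1 - s) ^ 2 + (s * d) ^ 2)) := by gcongr; exact add_sq_le
      _ = c * (1 - s) ^ 2 + s ^ 2 * (c * d ^ 2) := by ring
      _ ≤ 1 / 4 * (1 - s) ^ 2 + s ^ 2 * (c * d ^ 2) := by gcongr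
      _ = _ := by ring
  have hcd : 0 ≤ c * d ^ 2 := by positivity
  have hgain : 0 ≤ s * (c * d ^ 2) * (1 - s * (c * d ^ 2)) :=
    mul_nonneg (by positivity) (by nlinarith)
  nlinarith [pow_le_pow_left₀ (norm_nonneg _) hmid 2]

theorem TwoUniformlyConvex.exists_stronglyConvexSq (h : TwoUniformlyConvex E) :
    ∃ c, 0 < c ∧ StronglyConvexSq E c := by
  obtain ⟨c₀, hc₀, hmod⟩ := h.exists_modulus
  set c := min (1 / 4) c₀
  have hc : 0 < c := by positivity
  have hball (x y : E) (hx : ‖x‖ ≤ 1) (hy : ‖y‖ ≤ 1) :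
      c * ‖x - y‖ ^ 2 ≤ 1 - ‖(1 / 2 : ℝ) • (x + y)‖ :=
    (by gcongr; exact min_le_right _ _ : _ ≤ c₀ * ‖x - y‖ ^ 2).trans (hmod x y hx hy)
  have hmid (x y : E) (hyx : ‖y‖ ≤ ‖x‖) :
      ‖(1 / 2 : ℝ) • (x + y)‖ ^ 2 + c / 2 * ‖x - y‖ ^ 2 ≤ (‖x‖ ^ 2 + ‖y‖ ^ 2) / 2 := by
    have hunit (z : E) : ‖‖z‖⁻¹ • z‖ ≤ 1 := by
      rw [norm_smul, norm_inv, norm_norm]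
      exact inv_mul_le_one
    have hinv := midpoint_smul_sq_le hc.le (min_le_left _ _) (hunit x)
      (hball _ _ (hunit x) (hunit y)) (by positivity) (div_le_one_of_le₀ hyx (norm_nonneg x))
    rcases eq_or_ne x 0 with rfl | hx
    · simp [norm_le_zero_iff.mp (hyx.trans_eq norm_zero)]
    rw [show (‖y‖ / ‖x‖) • ‖y‖⁻¹ • y = ‖x‖⁻¹ • y by
        rcases eq_or_ne y 0 with rfl | hy
        · simp
        · rw [smul_smul, div_mul_eq_mul_div, mul_inv_cancel₀ (norm_ne_zero_iff.mpr hy), one_div],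
      ← smul_add, ← smul_sub, smul_comm, norm_smul, norm_smul _ (x - y), norm_inv, norm_norm,
      ← mul_le_mul_iff_of_pos_left (by positivity : 0 < ‖x‖ ^ 2)] at hinv
    field_simp at hinv ⊢
    linarith
  refine ⟨2 * c, by positivity, stronglyConvexSq_iff_midpoint.mpr fun x y => ?_⟩
  rcases le_total ‖y‖ ‖x‖ with hxy | hxy
  · linarith [hmid x y hxy]
  · rw [add_comm x y, norm_sub_rev x y]
    linarith [hmid y x hxy]

theorem stronglyConvexSq_inv_sq_iff {m : ℝ} : StronglyConvexSq E (m⁻¹ ^ 2) ↔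
    ∀ x y : E, ‖x‖ ^ 2 + ‖m⁻¹ • y‖ ^ 2 ≤ (‖x + y‖ ^ 2 + ‖x - y‖ ^ 2) / 2 := by
  simp only [StronglyConvexSq, norm_smul, mul_pow, Real.norm_eq_abs, sq_abs]

theorem TwoUniformlyConvex.exists_stronglyConvexSq_inv_sq (h : TwoUniformlyConvex E) :
    ∃ m, 1 ≤ m ∧ StronglyConvexSq E (m⁻¹ ^ 2) := by
  obtain ⟨c, hc₀, hc⟩ := h.exists_stronglyConvexSq
  refine ⟨max 1 c⁻¹, le_max_left _ _, fun x y => le_trans ?_ (hc x y)⟩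
  have hm₀ : 0 ≤ (max 1 c⁻¹)⁻¹ := by positivity
  have hm₁ : (max 1 c⁻¹)⁻¹ ≤ 1 := inv_le_one_of_one_le₀ (le_max_left _ _)
  have hmc : (max 1 c⁻¹)⁻¹ ≤ c := inv_le_of_inv_le₀ hc₀ (le_max_right _ _)
  gcongr
  exact (pow_le_of_le_one hm₀ hm₁ two_ne_zero).trans hmc

theorem TwoUniformlyConvex.stronglyConvexSq (h : TwoUniformlyConvex E) :
    1 ≤ uniformConvexityConst E ∧ StronglyConvexSq E ((uniformConvexityConst E)⁻¹ ^ 2) := by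
  have hne : {m : ℝ | 1 ≤ m ∧ ∀ x y : E,
      ‖x‖ ^ 2 + ‖m⁻¹ • y‖ ^ 2 ≤ (‖x + y‖ ^ 2 + ‖x - y‖ ^ 2) / 2}.Nonempty := by
    obtain ⟨m, hm, hc⟩ := h.exists_stronglyConvexSq_inv_sq
    exact ⟨m, hm, stronglyConvexSq_inv_sq_iff.mp hc⟩
  obtain ⟨m, -, hlim, hm⟩ := exists_seq_tendsto_sInf hne ⟨1, fun _ hk => hk.1⟩
  have hone : 1 ≤ uniformConvexityConst E := ge_of_tendsto' hlim fun n => (hm n).1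
  refine ⟨hone, fun x y => ?_⟩
  exact le_of_tendsto' ((((hlim.inv₀ (by positivity)).pow 2).mul_const _).const_add _)
    fun n => stronglyConvexSq_inv_sq_iff.mpr (hm n).2 x y

theorem uniformSmoothnessConst_nonneg (F : Type*) [NormedAddCommGroup F] [NormedSpace ℝ F] :
    0 ≤ uniformSmoothnessConst F :=
  Real.sInf_nonneg fun _ hk => hk.1.le

theorem StronglyConvexSq.norm_add_sq_le_uniformSmoothnessConst [CompleteSpace E] {c : ℝ}
    (hc : StronglyConvexSq E c) (hc₀ : 0 < c) {x : E} {f : StrongDual ℝ E}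
    (hf : f ∈ dualitySet x) (g : StrongDual ℝ E) :
    ‖f + g‖ ^ 2 ≤ ‖f‖ ^ 2 + 2 * g x +
      2 * uniformSmoothnessConst (StrongDual ℝ E) ^ 2 * ‖g‖ ^ 2 := by
  have hdual {x : E} {f : StrongDual ℝ E} (hf : f ∈ dualitySet x) (g : StrongDual ℝ E) :
      dualityMap f g = g x := by
    rw [hc.bidual_eq_inclusion hc₀ hf (dualityMap_mem f), NormedSpace.dual_def]
  have hk₀ : √(c⁻¹ / 2) ∈ {k : ℝ | 0 < k ∧ ∀ f g : StrongDual ℝ E,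
      ‖f + g‖ ^ 2 ≤ ‖f‖ ^ 2 + 2 * dualityMap f g + 2 * k ^ 2 * ‖g‖ ^ 2} := by
    refine ⟨by positivity, fun f g => ?_⟩
    obtain ⟨x, hx⟩ := hc.exists_mem_dualitySet hc₀ f
    rw [hdual hx, Real.sq_sqrt (by positivity), mul_div_cancel₀ _ two_ne_zero]
    exact hc.norm_add_sq_le_dual hc₀ hx g
  obtain ⟨k, -, hlim, hk⟩ := exists_seq_tendsto_sInf ⟨_, hk₀⟩ ⟨0, fun _ hk => hk.1.le⟩
  rw [← hdual hf]
  exact ge_of_tendsto' ((((hlim.pow 2).const_mul 2).mul_const _).const_add _) fun n => (hk n).2 f g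

end Constants

section UniformSmoothness

variable {E : Type*} [NormedAddCommGroup E] [NormedSpace ℝ E]

theorem one_add_apply_le_norm_add {x : E} {f : StrongDual ℝ E} (h : f ∈ dualitySet x)
    (hx : ‖x‖ = 1) (y : E) : 1 + f y ≤ ‖x + y‖ := by
  have hxy := apply_le_norm_mul_norm f (x + y)
  rw [map_add, apply_self_of_mem_dualitySet h, norm_of_mem_dualitySet h, hx] at hxy
  linarith

/-- The difference quotient along `-y` bounds the derivative of the norm by `f`. -/
theorem UniformlySmooth.exists_norm_add_le_of_norm_eq_one (hE : UniformlySmooth E) {ε : ℝ}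
    (hε : 0 < ε) : ∃ δ > 0, ∀ x : E, ∀ f ∈ dualitySet x, ‖x‖ = 1 → ∀ y, ‖y‖ < δ →
      ‖x + y‖ ≤ 1 + f y + ε * ‖y‖ := by
  obtain ⟨G, hG⟩ := hE
  obtain ⟨δ, hδ, hball⟩ := Metric.mem_nhdsWithin_iff.mp
    (Metric.tendstoUniformlyOn_iff.mp hG (ε / 2) (half_pos hε))
  refine ⟨δ, hδ, fun x f hf hx y hyδ => ?_⟩
  rcases eq_or_ne y 0 with rfl | hy
  · simp [hx]
  have hy₀ : 0 < ‖y‖ := norm_pos_iff.mpr hy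
  obtain ⟨d, hd, hyd⟩ : ∃ d : E, ‖d‖ = 1 ∧ ‖y‖ • d = y :=
    ⟨‖y‖⁻¹ • y, norm_smul_inv_norm (𝕜 := ℝ) hy, smul_inv_smul₀ hy₀.ne' y⟩
  have hquot (t : ℝ) (ht₀ : t ≠ 0) (ht : |t| < δ) :
      |G (x, d) - (‖x + t • d‖ - 1) / t| < ε / 2 := by
    have := hball ⟨by simpa using ht, ht₀⟩ (x, d) ⟨by simpa using hx, by simpa using hd⟩
    simpa [hx, Real.dist_eq] using this
  have hright := (abs_lt.mp (hquot ‖y‖ hy₀.ne' (by rwa [abs_norm]))).1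
  have hleft := (abs_lt.mp (hquot (-‖y‖) (neg_ne_zero.mpr hy₀.ne')
    (by rwa [abs_neg, abs_norm]))).2
  have hsub : (‖x + (-‖y‖) • d‖ - 1) / (-‖y‖) ≤ f d := by
    rw [div_le_iff_of_neg (by linarith)]
    have := one_add_apply_le_norm_add hf hx ((-‖y‖) • d)
    rw [map_smul, smul_eq_mul] at this
    linarith
  have hle : (‖x + y‖ - 1) / ‖y‖ ≤ f d + ε := by
    rw [hyd] at hright
    linarith
  have hfy : f y = ‖y‖ * f d := by rw [← smul_eq_mul, ← map_smul, hyd]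
  rw [div_le_iff₀ hy₀] at hle
  linarith

theorem UniformlySmooth.exists_norm_add_sq_le (hE : UniformlySmooth E) (R : ℝ) {ε : ℝ}
    (hε : 0 < ε) : ∃ δ > 0, ∀ x : E, ∀ f ∈ dualitySet x, ‖x‖ ≤ R → ∀ y, ‖y‖ < δ →
      ‖x + y‖ ^ 2 ≤ ‖x‖ ^ 2 + 2 * f y + ε * ‖y‖ := by
  obtain ⟨δ, hδ, hsphere⟩ :=
    hE.exists_norm_add_le_of_norm_eq_one (by positivity : 0 < ε / (4 * (|R| + 1)))
  refine ⟨min (ε / 2) (ε / 8 * δ), by positivity, fun x f hf hxR y hy => ?_⟩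
  have hyε : ‖y‖ ≤ ε / 2 := hy.le.trans (min_le_left _ _)
  have hd : |‖x + y‖ - ‖x‖| ≤ ‖y‖ := by
    simpa only [add_sub_cancel_left] using abs_norm_sub_norm_le (x + y) x
  have hd_sq : (‖x + y‖ - ‖x‖) ^ 2 ≤ ε / 2 * ‖y‖ := by
    rw [← sq_abs]
    nlinarith [abs_nonneg (‖x + y‖ - ‖x‖), norm_nonneg y]
  suffices h : ‖x‖ * (‖x + y‖ - ‖x‖) ≤ f y + ε / 4 * ‖y‖ by linarith
  rcases le_or_gt ‖x‖ (ε / 8) with hx | hx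
  · have hfy := apply_le_norm_mul_norm f (-y)
    rw [map_neg, norm_neg, norm_of_mem_dualitySet hf] at hfy
    have hxd : ‖x‖ * (‖x + y‖ - ‖x‖) ≤ ‖x‖ * ‖y‖ := by gcongr; exact (le_abs_self _).trans hd
    have : ‖x‖ * ‖y‖ ≤ ε / 8 * ‖y‖ := by gcongr
    linarith
  · have hx₀ : 0 < ‖x‖ := by linarith
    have hyδ : ‖‖x‖⁻¹ • y‖ < δ := by
      rw [norm_smul, norm_inv, norm_norm, inv_mul_lt_iff₀ hx₀]
      exact (hy.trans_le (min_le_right _ _)).trans (by gcongr)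
    have h := hsphere _ _ (smul_mem_dualitySet hf ‖x‖⁻¹)
      (norm_smul_inv_norm (𝕜 := ℝ) (norm_pos_iff.mp hx₀)) _ hyδ
    rw [← smul_add, norm_smul, norm_smul, norm_inv, norm_norm, smul_apply, map_smul,
      smul_eq_mul, smul_eq_mul, ← mul_le_mul_iff_of_pos_left (by positivity : 0 < ‖x‖ ^ 2)] at h
    have hεR : ‖x‖ * (ε / (4 * (|R| + 1))) ≤ ε / 4 := by
      rw [mul_div_assoc', div_le_iff₀ (by positivity)]
      nlinarith [le_abs_self R]
    have hεy : ‖x‖ * (ε / (4 * (|R| + 1))) * ‖y‖ ≤ ε / 4 * ‖y‖ := by gcongr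
    have hl : ‖x‖ ^ 2 * (‖x‖⁻¹ * ‖x + y‖) = ‖x‖ * ‖x + y‖ := by field_simp
    have hr (s : ℝ) : ‖x‖ ^ 2 * (1 + ‖x‖⁻¹ * (‖x‖⁻¹ * f y) + s * (‖x‖⁻¹ * ‖y‖)) =
        ‖x‖ ^ 2 + f y + ‖x‖ * s * ‖y‖ := by field_simp
    rw [hl, hr] at h
    linarith

theorem UniformlySmooth.exists_norm_sub_le (hE : UniformlySmooth E) (R : ℝ) {ε : ℝ}
    (hε : 0 < ε) : ∃ δ > 0, ∀ x : E, ∀ f ∈ dualitySet x, ‖x‖ ≤ R → ∀ u, ∀ g ∈ dualitySet u,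
      ‖u - x‖ < δ → ‖g - f‖ ≤ ε := by
  obtain ⟨δ, hδ, h⟩ := hE.exists_norm_add_sq_le R hε
  refine ⟨δ / 2, half_pos hδ, fun x f hf hxR u g hg hux => ?_⟩
  have hle (d : E) (hd : ‖d‖ = 1) : (g - f) d ≤ ε := by
    have hnorm : ‖u - x + (δ / 2) • d‖ < δ := by
      calc ‖u - x + (δ / 2) • d‖ ≤ ‖u - x‖ + δ / 2 :=
            norm_add_le_of_le le_rfl (by rw [norm_smul_of_nonneg (by positivity), hd, mul_one])
        _ < δ := by linarith
    have hsmooth := h x f hf hxR _ hnorm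
    have hx := subgradient_of_mem_dualitySet hf (u - x)
    have hu := subgradient_of_mem_dualitySet hg ((δ / 2) • d)
    rw [show x + (u - x + (δ / 2) • d) = u + (δ / 2) • d by abel, map_add, map_smul,
      smul_eq_mul] at hsmooth
    rw [add_sub_cancel] at hx
    rw [map_smul, smul_eq_mul] at hu
    have : δ * ((g - f) d) ≤ δ * ε := by
      rw [sub_apply]
      nlinarith
    exact le_of_mul_le_mul_left this hδ
  refine ContinuousLinearMap.opNorm_le_of_unit_norm hε.le fun d hd => abs_le'.mpr ⟨hle d hd, ?_⟩
  rw [← map_neg]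
  exact hle (-d) (by rwa [norm_neg])

theorem UniformlySmooth.eq_of_mem_dualitySet (hE : UniformlySmooth E) {x : E}
    {f g : StrongDual ℝ E} (hf : f ∈ dualitySet x) (hg : g ∈ dualitySet x) : f = g := by
  refine (eq_of_norm_sub_le_zero (le_of_forall_pos_le_add fun ε hε => ?_)).symm
  obtain ⟨δ, hδ, h⟩ := hE.exists_norm_sub_le ‖x‖ hε
  rw [zero_add]
  exact h x f hf le_rfl x g hg (by rwa [sub_self, norm_zero])

theorem UniformlySmooth.tendsto_dualityMap_sub (hE : UniformlySmooth E) {ι : Type*}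
    {l : Filter ι} {x u : ι → E} {R : ℝ} (hR : ∀ᶠ i in l, ‖x i‖ ≤ R)
    (h : Tendsto (fun i => u i - x i) l (𝓝 0)) :
    Tendsto (fun i => dualityMap (u i) - dualityMap (x i)) l (𝓝 0) := by
  refine Metric.tendsto_nhds.mpr fun ε hε => ?_
  obtain ⟨δ, hδ, hδε⟩ := hE.exists_norm_sub_le R (half_pos hε)
  filter_upwards [hR, Metric.tendsto_nhds.mp h δ hδ] with i hi hux
  rw [dist_zero_right] at hux ⊢
  exact (hδε _ _ (dualityMap_mem _) hi _ _ (dualityMap_mem _) hux).trans_lt (half_lt_self hε)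

end UniformSmoothness

section ReflexiveSpaces

variable {E : Type*} [NormedAddCommGroup E] [NormedSpace ℝ E]

theorem exists_mem_dualitySet_of_surjective_inclusion
    (hrefl : Function.Surjective (NormedSpace.inclusionInDoubleDual ℝ E)) (f : StrongDual ℝ E) :
    ∃ x, f ∈ dualitySet x := by
  obtain ⟨x, hx⟩ := hrefl (dualityMap f)
  have hf := dualityMap_mem f
  rw [← hx, mem_dualitySet_iff_norm_sq_add_norm_sq_le, NormedSpace.dual_def] at hf
  have hnorm : ‖NormedSpace.inclusionInDoubleDual ℝ E x‖ = ‖x‖ :=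
    (NormedSpace.inclusionInDoubleDualLi ℝ).norm_map x
  rw [hnorm, add_comm] at hf
  exact ⟨x, mem_dualitySet_iff_norm_sq_add_norm_sq_le.mpr hf⟩

theorem UniformlySmooth.dualityMap_dualityInv (hE : UniformlySmooth E)
    (hrefl : Function.Surjective (NormedSpace.inclusionInDoubleDual ℝ E)) (f : StrongDual ℝ E) :
    dualityMap (dualityInv f) = f := by
  obtain ⟨x, hx⟩ := exists_mem_dualitySet_of_surjective_inclusion hrefl f
  exact Function.invFun_eq ⟨x, hE.eq_of_mem_dualitySet (dualityMap_mem x) hx⟩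

theorem exists_weak_limit
    (hrefl : Function.Surjective (NormedSpace.inclusionInDoubleDual ℝ E)) {ι : Type*}
    (U : Ultrafilter ι) {u : ι → E} {R : ℝ} (hR : ∀ᶠ i in (U : Filter ι), ‖u i‖ ≤ R) :
    ∃ p : E, ∀ f : StrongDual ℝ E, Tendsto (fun i => f (u i)) U (𝓝 (f p)) := by
  have hcompact : IsCompact (closure (toWeakSpace ℝ E '' Metric.closedBall 0 R)) := by
    refine NormedSpace.isCompact_closure_of_isBounded ℝ E _ ?_ ?_
    · rw [Set.preimage_image_eq _ (toWeakSpace ℝ E).injective]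
      exact Metric.isBounded_closedBall
    · exact fun F _ => hrefl F
  have hmem : ∀ᶠ i in (U : Filter ι),
      toWeakSpace ℝ E (u i) ∈ closure (toWeakSpace ℝ E '' Metric.closedBall 0 R) :=
    hR.mono fun i hi => subset_closure ⟨_, mem_closedBall_zero_iff.mpr hi, rfl⟩
  obtain ⟨p, -, hp⟩ := hcompact.ultrafilter_le_nhds (U.map fun i => toWeakSpace ℝ E (u i))
    (le_principal_iff.mpr hmem)
  exact ⟨(toWeakSpace ℝ E).symm p, fun f =>
    ((WeakBilin.eval_continuous (topDualPairing ℝ E).flip f).tendsto p).comp hp⟩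

end ReflexiveSpaces

section Separation

theorem convexOn_norm_sq (V : Type*) [NormedAddCommGroup V] [NormedSpace ℝ V] :
    ConvexOn ℝ Set.univ fun x : V => ‖x‖ ^ 2 :=
  convexOn_univ_norm.pow (fun x _ => norm_nonneg x) 2

theorem exists_affine_between {V : Type*} [NormedAddCommGroup V] [NormedSpace ℝ V] {φ : V → ℝ}
    (hφ : ConvexOn ℝ Set.univ φ) (hcont : Continuous φ) {S : Set (V × ℝ)} (hS : Convex ℝ S)
    (hne : S.Nonempty) (h : ∀ q ∈ S, -φ q.1 ≤ q.2) :
    ∃ (ℓ : StrongDual ℝ V) (c : ℝ), (∀ v, -φ v ≤ ℓ v + c) ∧ ∀ q ∈ S, ℓ q.1 + c ≤ q.2 := by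
  have hconvex : Convex ℝ {q : V × ℝ | q.2 < -φ q.1} := by
    simpa only [Set.mem_univ, true_and, Pi.neg_apply] using hφ.neg.convex_strict_hypograph
  have hopen : IsOpen {q : V × ℝ | q.2 < -φ q.1} := isOpen_lt (by fun_prop) (by fun_prop)
  obtain ⟨k, u, hlt, hle⟩ := geometric_hahn_banach_open hconvex hopen hS
    (Set.disjoint_left.mpr fun q hq hqS => (h q hqS).not_gt hq)
  obtain ⟨s, hs⟩ : ∃ s : ℝ, ∀ v t, k (v, t) = k (v, 0) + t * s := ⟨k (0, 1), fun v t => by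
    rw [← smul_eq_mul t, ← map_smul, ← map_add]
    simp⟩
  have hbelow (v : V) : k (v, 0) - s * φ v ≤ u := by
    have hlim : Tendsto (fun t : ℝ => k (v, 0) + t * s) (𝓝[<] (-φ v)) (𝓝 (k (v, 0) + -φ v * s)) :=
      (Continuous.tendsto (by fun_prop) _).mono_left nhdsWithin_le_nhds
    have := le_of_tendsto hlim (eventually_nhdsWithin_of_forall fun t ht =>
      (hs v t).symm.trans_le (hlt (v, t) ht).le)
    linarith
  have hpos : 0 < s := by
    obtain ⟨⟨v, t⟩, hv⟩ := hne
    have habove := hle _ hv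
    have hstrict := hlt (v, -φ v - 1) (show -φ v - 1 < -φ v from sub_one_lt _)
    have hvt : -φ v ≤ t := h _ hv
    rw [hs] at habove hstrict
    nlinarith
  have haffine (v : V) : (-s⁻¹ • k.comp (.inl ℝ V ℝ)) v + s⁻¹ * u = s⁻¹ * (u - k (v, 0)) := by
    simp only [smul_apply, ContinuousLinearMap.comp_apply, ContinuousLinearMap.inl_apply,
      smul_eq_mul]
    ring
  refine ⟨-s⁻¹ • k.comp (.inl ℝ V ℝ), s⁻¹ * u, fun v => ?_, fun ⟨v, t⟩ hq => ?_⟩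
  · rw [haffine, le_inv_mul_iff₀ hpos]
    linarith [hbelow v]
  · rw [haffine, inv_mul_le_iff₀ hpos]
    linarith [hle _ hq, hs v t]

end Separation

section MonotoneOperators

variable {E : Type*} [NormedAddCommGroup E] [NormedSpace ℝ E] {B : E → Set (StrongDual ℝ E)}

theorem isMaximalMonotone_iff : IsMaximalMonotone B ↔
    ∀ x f, f ∈ B x ↔ ∀ y, ∀ g ∈ B y, 0 ≤ (f - g) (x - y) := by
  refine ⟨fun hB x f => ⟨fun hf y g hg => hB.1 x y f hf g hg, fun h => ?_⟩,
    fun h => ⟨fun x y f hf => (h x f).mp hf y, fun S hS hBS => ?_⟩⟩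
  · rw [hB.2 (fun y => B y ∪ {g | y = x ∧ g = f}) ?_ fun y => Set.subset_union_left]
    · exact Or.inr ⟨rfl, rfl⟩
    · rintro y z g (hg | ⟨rfl, rfl⟩) k (hk | ⟨rfl, rfl⟩)
      · exact hB.1 y z g hg k hk
      · have := h y g hg
        rwa [← neg_sub g, ← neg_sub y, map_neg, neg_apply, neg_neg] at this
      · exact h z k hk
      · simp
  · exact funext fun x => (hBS x).antisymm fun f hf =>
      (h x f).mpr fun y g hg => hS x y f hf g (hBS y hg)

theorem IsMaximalMonotone.exists_nonempty (hB : IsMaximalMonotone B) : ∃ x, (B x).Nonempty := by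
  by_contra! hempty
  have hmem : (0 : StrongDual ℝ E) ∈ B 0 :=
    (isMaximalMonotone_iff.mp hB 0 0).mpr fun y g hg => by simp [hempty y] at hg
  simp [hempty 0] at hmem

theorem IsMaximalMonotone.affine (hB : IsMaximalMonotone B) {r : ℝ} (hr : 0 < r) (x₀ : E)
    (p : StrongDual ℝ E) : IsMaximalMonotone fun z => {f | r⁻¹ • (f + p) ∈ B (z + x₀)} := by
  refine isMaximalMonotone_iff.mpr fun x f => ?_
  have hscale (g : StrongDual ℝ E) (d : E) :
      0 ≤ (r⁻¹ • (f + p) - r⁻¹ • (g + p)) d ↔ 0 ≤ (f - g) d := by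
    rw [show r⁻¹ • (f + p) - r⁻¹ • (g + p) = r⁻¹ • (f - g) by module, smul_apply, smul_eq_mul]
    exact mul_nonneg_iff_of_pos_left (inv_pos.mpr hr)
  rw [Set.mem_ofPred_eq, isMaximalMonotone_iff.mp hB]
  refine ⟨fun h y g hg => ?_, fun h y g hg => ?_⟩
  · rw [← hscale]
    simpa only [add_sub_add_right_eq_sub] using h _ _ hg
  · have hg' : r⁻¹ • (r • g - p + p) = g := by rw [sub_add_cancel, inv_smul_smul₀ hr.ne']
    have hy := h (y - x₀) (r • g - p) (by rwa [Set.mem_ofPred_eq, hg', sub_add_cancel])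
    rwa [← hscale, hg', sub_sub_eq_add_sub] at hy

/-- The epigraph of the Fitzpatrick function
`(x, f) ↦ sup {g x + f y - g y | g ∈ B y}` of the operator `B`. -/
def fitzpatrickEpigraph (B : E → Set (StrongDual ℝ E)) : Set ((E × StrongDual ℝ E) × ℝ) :=
  {q | ∀ y, ∀ g ∈ B y, g q.1.1 + q.1.2 y - g y ≤ q.2}

theorem convex_fitzpatrickEpigraph (B : E → Set (StrongDual ℝ E)) :
    Convex ℝ (fitzpatrickEpigraph B) := by
  intro q hq q' hq' a b ha hb hab y g hg
  calc g (a • q.1.1 + b • q'.1.1) + (a • q.1.2 + b • q'.1.2) y - g y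
      = a * (g q.1.1 + q.1.2 y - g y) + b * (g q'.1.1 + q'.1.2 y - g y) := by
        simp only [map_add, map_smul, add_apply, smul_apply, smul_eq_mul]
        linear_combination g y * hab
    _ ≤ a * q.2 + b * q'.2 :=
        add_le_add (mul_le_mul_of_nonneg_left (hq y g hg) ha)
          (mul_le_mul_of_nonneg_left (hq' y g hg) hb)

theorem IsMonotoneOperator.mem_fitzpatrickEpigraph (hB : IsMonotoneOperator B) {x : E}
    {f : StrongDual ℝ E} (hf : f ∈ B x) : ((x, f), f x) ∈ fitzpatrickEpigraph B := by
  intro y g hg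
  have h := hB x y f hf g hg
  rw [sub_apply, map_sub, map_sub] at h
  linarith

theorem IsMaximalMonotone.apply_le_of_mem_fitzpatrickEpigraph (hB : IsMaximalMonotone B) {x : E}
    {f : StrongDual ℝ E} {t : ℝ} (h : ((x, f), t) ∈ fitzpatrickEpigraph B) : f x ≤ t := by
  by_contra! hlt
  have hf : f ∈ B x := (isMaximalMonotone_iff.mp hB x f).mpr fun y g hg => by
    have := h y g hg
    rw [sub_apply, map_sub, map_sub]
    linarith
  have := h x f hf
  linarith

/-- Rockafellar's surjectivity theorem. An affine function separating the Fitzpatrick function of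
`B` from the concave function `(x, f) ↦ -(‖x‖² + ‖f‖²) / 2` is, by reflexivity, of the form
`(x, f) ↦ g x + f y + c`, and then `(y, g)` is the required point of the graph. -/
theorem IsMaximalMonotone.exists_neg_mem_dualitySet (hB : IsMaximalMonotone B)
    (hrefl : Function.Surjective (NormedSpace.inclusionInDoubleDual ℝ E)) :
    ∃ y, ∃ g ∈ B y, -g ∈ dualitySet y := by
  have hφ : ConvexOn ℝ Set.univ
      fun q : E × StrongDual ℝ E => 1 / 2 * (‖q.1‖ ^ 2 + ‖q.2‖ ^ 2) :=
    (((convexOn_norm_sq E).comp_linearMap (.fst ℝ E (StrongDual ℝ E))).add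
      ((convexOn_norm_sq (StrongDual ℝ E)).comp_linearMap (.snd ℝ E (StrongDual ℝ E)))).smul
      (by norm_num)
  obtain ⟨x₁, f₁, hf₁⟩ := hB.exists_nonempty
  obtain ⟨ℓ, c, hlower, hupper⟩ := exists_affine_between hφ (by fun_prop)
    (convex_fitzpatrickEpigraph B) ⟨_, hB.1.mem_fitzpatrickEpigraph hf₁⟩ fun ⟨⟨x, f⟩, t⟩ hq => by
      have hxf := two_mul_apply_le (-f) x
      rw [norm_neg, neg_apply] at hxf
      linarith [hB.apply_le_of_mem_fitzpatrickEpigraph hq]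
  set g : StrongDual ℝ E := ℓ.comp (.inl ℝ E _)
  obtain ⟨y, hy⟩ := hrefl (ℓ.comp (.inr ℝ E _))
  have hℓ (x : E) (f : StrongDual ℝ E) : ℓ (x, f) = g x + f y := by
    rw [← NormedSpace.dual_def ℝ E y f, hy]
    simp [g, ← map_add]
  have hc : ‖g‖ ^ 2 + ‖y‖ ^ 2 ≤ 2 * c := by
    obtain ⟨x, hx⟩ := exists_mem_dualitySet_of_surjective_inclusion hrefl (-g)
    have hlow := hlower (x, -dualityMap y)
    have hgx := hx.1
    simp only [hℓ, norm_neg, neg_apply, norm_dualityMap, dualityMap_self, ← hx.2] at hlow hgx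
    linarith
  have hgraph (x : E) (f : StrongDual ℝ E) (hf : f ∈ B x) : g x + f y + c ≤ f x := by
    rw [← hℓ]
    exact hupper _ (hB.1.mem_fitzpatrickEpigraph hf)
  have hgy : g ∈ B y := (isMaximalMonotone_iff.mp hB y g).mpr fun x f hf => by
    have hneg := two_mul_apply_le (-g) y
    rw [norm_neg, neg_apply] at hneg
    rw [sub_apply, map_sub, map_sub]
    linarith [hgraph x f hf]
  refine ⟨y, g, hgy, mem_dualitySet_iff_norm_sq_add_norm_sq_le.mpr ?_⟩
  rw [norm_neg, neg_apply]
  linarith [hgraph y g hgy]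

theorem IsMaximalMonotone.exists_sub_smul_mem_dualitySet (hB : IsMaximalMonotone B)
    (hrefl : Function.Surjective (NormedSpace.inclusionInDoubleDual ℝ E)) {r : ℝ} (hr : 0 < r)
    (x₀ : E) (p : StrongDual ℝ E) : ∃ z, ∃ v ∈ B z, p - r • v ∈ dualitySet (z - x₀) := by
  obtain ⟨y, g, hg, hgy⟩ := (hB.affine hr x₀ p).exists_neg_mem_dualitySet hrefl
  refine ⟨y + x₀, _, hg, ?_⟩
  rwa [smul_inv_smul₀ hr.ne', add_sub_cancel_right, sub_add_cancel_right]

theorem IsMaximalMonotone.dualityMap_eq_dualityMap_resolvent_add (hB : IsMaximalMonotone B)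
    (hE : UniformlySmooth E)
    (hrefl : Function.Surjective (NormedSpace.inclusionInDoubleDual ℝ E)) {r : ℝ} (hr : 0 < r)
    (x : E) : ∃ v ∈ B (resolvent B r x), dualityMap x = dualityMap (resolvent B r x) + r • v := by
  obtain ⟨z, v, hv, hz⟩ := hB.exists_sub_smul_mem_dualitySet hrefl hr 0 (dualityMap x)
  rw [sub_zero] at hz
  exact Classical.epsilon_spec (p := fun z : E => ∃ v ∈ B z, dualityMap x = dualityMap z + r • v)
    ⟨z, v, hv, by rw [hE.eq_of_mem_dualitySet (dualityMap_mem z) hz, sub_add_cancel]⟩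

variable {A : E → StrongDual ℝ E} {L : ℝ}

theorem add_apply_sub_nonneg_of_mem_solutionSet (hA_mono : ∀ x y : E, 0 ≤ (A x - A y) (x - y))
    (hB : IsMonotoneOperator B) {y z : E} (hz : z ∈ solutionSet A B) {v : StrongDual ℝ E}
    (hv : v ∈ B y) : 0 ≤ (A y + v) (y - z) := by
  obtain ⟨v₀, hv₀, hz⟩ := hz
  rw [show A y + v = (A y - A z) + (v - v₀) by rw [eq_neg_of_add_eq_zero_left hz]; abel, add_apply]
  exact add_nonneg (hA_mono y z) (hB y z v hv v₀ hv₀)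

/-- Minty's characterization of the zeros of `A + B`. The converse tests the inequality at the
solution `y` of `J (y - z) + r B y ∋ -r A z`, where `r = 1 / (2 L)`. -/
theorem mem_solutionSet_iff
    (hrefl : Function.Surjective (NormedSpace.inclusionInDoubleDual ℝ E)) (hL : 0 < L)
    (hA_mono : ∀ x y : E, 0 ≤ (A x - A y) (x - y))
    (hA_lip : ∀ x y : E, ‖A x - A y‖ ≤ L * ‖x - y‖) (hB : IsMaximalMonotone B) {z : E} :
    z ∈ solutionSet A B ↔ ∀ y, ∀ v ∈ B y, 0 ≤ (A y + v) (y - z) := by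
  constructor
  · exact fun hz y v hv => add_apply_sub_nonneg_of_mem_solutionSet hA_mono hB.1 hz hv
  · intro h
    obtain ⟨y, v, hv, hyv⟩ := hB.exists_sub_smul_mem_dualitySet hrefl
      (r := (2 * L)⁻¹) (by positivity) z (-((2 * L)⁻¹ • A z))
    rw [← neg_add', ← smul_add, ← smul_neg] at hyv
    have hself : (A z + v) (y - z) = -(2 * L * ‖y - z‖ ^ 2) := by
      rw [← apply_self_of_mem_dualitySet hyv, smul_apply, neg_apply, smul_eq_mul,
        mul_inv_cancel_left₀ (by positivity), neg_neg]
    have hlip : (A y - A z) (y - z) ≤ L * ‖y - z‖ ^ 2 :=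
      calc (A y - A z) (y - z) ≤ ‖A y - A z‖ * ‖y - z‖ := apply_le_norm_mul_norm _ _
        _ ≤ L * ‖y - z‖ * ‖y - z‖ := by gcongr; exact hA_lip y z
        _ = L * ‖y - z‖ ^ 2 := by ring
    have hzero : L * ‖y - z‖ ^ 2 ≤ 0 := by
      have hy := h y v hv
      rw [show A y + v = (A y - A z) + (A z + v) by abel, add_apply] at hy
      linarith
    obtain rfl : y = z := by
      have := nonpos_of_mul_nonpos_right hzero hL
      exact sub_eq_zero.mp (norm_eq_zero.mp (pow_eq_zero_iff two_ne_zero |>.mp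
        (this.antisymm (sq_nonneg _))))
    have hnorm := norm_of_mem_dualitySet hyv
    rw [sub_self, norm_zero, norm_eq_zero, smul_eq_zero, neg_eq_zero] at hnorm
    exact ⟨v, hv, hnorm.resolve_left (by positivity)⟩

theorem solutionSet_eq_iInter
    (hrefl : Function.Surjective (NormedSpace.inclusionInDoubleDual ℝ E)) (hL : 0 < L)
    (hA_mono : ∀ x y : E, 0 ≤ (A x - A y) (x - y))
    (hA_lip : ∀ x y : E, ‖A x - A y‖ ≤ L * ‖x - y‖) (hB : IsMaximalMonotone B) :
    solutionSet A B = ⋂ (y) (v ∈ B y), {z | (A y + v) z ≤ (A y + v) y} := by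
  ext z
  simp only [mem_solutionSet_iff hrefl hL hA_mono hA_lip hB, Set.mem_iInter, Set.mem_ofPred_eq,
    map_sub, sub_nonneg]

theorem isClosed_solutionSet
    (hrefl : Function.Surjective (NormedSpace.inclusionInDoubleDual ℝ E)) (hL : 0 < L)
    (hA_mono : ∀ x y : E, 0 ≤ (A x - A y) (x - y))
    (hA_lip : ∀ x y : E, ‖A x - A y‖ ≤ L * ‖x - y‖) (hB : IsMaximalMonotone B) :
    IsClosed (solutionSet A B) := by
  rw [solutionSet_eq_iInter hrefl hL hA_mono hA_lip hB]
  exact isClosed_iInter fun y => isClosed_biInter fun v _ =>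
    isClosed_le (A y + v).continuous continuous_const

theorem convex_solutionSet
    (hrefl : Function.Surjective (NormedSpace.inclusionInDoubleDual ℝ E)) (hL : 0 < L)
    (hA_mono : ∀ x y : E, 0 ≤ (A x - A y) (x - y))
    (hA_lip : ∀ x y : E, ‖A x - A y‖ ≤ L * ‖x - y‖) (hB : IsMaximalMonotone B) :
    Convex ℝ (solutionSet A B) := by
  rw [solutionSet_eq_iInter hrefl hL hA_mono hA_lip hB]
  exact convex_iInter fun y => convex_iInter₂ fun v _ =>
    convex_halfSpace_le (A y + v).toLinearMap.isLinear _

end MonotoneOperators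

section Lyapunov

variable {E : Type*} [NormedAddCommGroup E] [NormedSpace ℝ E]

theorem StronglyConvexSq.mul_norm_sub_sq_le_lyapunov {c : ℝ} (hc : StronglyConvexSq E c) (x y : E) :
    c * ‖x - y‖ ^ 2 ≤ lyapunov x y := by
  have h := hc.subgradient (dualityMap_mem y) (x - y)
  rw [add_sub_cancel, map_sub, dualityMap_self] at h
  rw [lyapunov]
  linarith

theorem lyapunov_nonneg (x y : E) : 0 ≤ lyapunov x y := by
  have h := two_mul_apply_le (dualityMap y) x
  rw [norm_dualityMap] at h
  rw [lyapunov]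
  linarith

theorem StronglyConvexSq.norm_sub_le_sqrt_lyapunov {c : ℝ} (hc : StronglyConvexSq E c) (hc₀ : 0 < c)
    (x y : E) : ‖x - y‖ ≤ √(lyapunov x y / c) :=
  Real.le_sqrt_of_sq_le ((le_div_iff₀' hc₀).mpr (hc.mul_norm_sub_sq_le_lyapunov x y))

theorem StronglyConvexSq.tendsto_sub_of_tendsto_lyapunov {c : ℝ} (hc : StronglyConvexSq E c)
    (hc₀ : 0 < c) {ι : Type*} {l : Filter ι} {x y : ι → E}
    (h : Tendsto (fun i => lyapunov (x i) (y i)) l (𝓝 0)) :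
    Tendsto (fun i => x i - y i) l (𝓝 0) := by
  have hsqrt := (Real.continuous_sqrt.tendsto _).comp (h.div_const c)
  rw [zero_div, Real.sqrt_zero] at hsqrt
  exact squeeze_zero_norm (fun i => hc.norm_sub_le_sqrt_lyapunov hc₀ _ _) hsqrt

section Anchor

variable {x₁ w u : E} {t : ℝ}

theorem lyapunov_le_of_dualityMap_eq (ht₀ : 0 ≤ t) (ht₁ : t ≤ 1)
    (hu : dualityMap u = t • dualityMap x₁ + (1 - t) • dualityMap w) (p : E) :
    lyapunov p u ≤ t * lyapunov p x₁ + (1 - t) * lyapunov p w := by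
  have h := (convexOn_norm_sq (StrongDual ℝ E)).2 (Set.mem_univ (dualityMap x₁))
    (Set.mem_univ (dualityMap w)) ht₀ (sub_nonneg.mpr ht₁) (add_sub_cancel t 1)
  rw [← hu] at h
  simp only [norm_dualityMap, smul_eq_mul] at h
  simp only [lyapunov, hu, add_apply, smul_apply, smul_eq_mul]
  linarith

theorem lyapunov_le_mul_add_of_dualityMap_eq (ht₀ : 0 ≤ t) (ht₁ : t ≤ 1)
    (hu : dualityMap u = t • dualityMap x₁ + (1 - t) • dualityMap w) (z : E) :
    lyapunov z u ≤ (1 - t) * lyapunov z w +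
      t * (2 * (dualityMap x₁ - dualityMap z) (u - z)) := by
  have hconvex := (convexOn_norm_sq (StrongDual ℝ E)).2 (Set.mem_univ (dualityMap z))
    (Set.mem_univ (dualityMap w)) ht₀ (sub_nonneg.mpr ht₁) (add_sub_cancel t 1)
  have hyoung := two_mul_apply_le (t • dualityMap z + (1 - t) • dualityMap w) u
  have huu := dualityMap_self u
  simp only [norm_dualityMap, smul_eq_mul] at hconvex
  simp only [hu, add_apply, smul_apply, smul_eq_mul] at hyoung huu
  simp only [lyapunov, hu, add_apply, sub_apply, smul_apply, smul_eq_mul, map_sub,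
    dualityMap_self z]
  linarith

end Anchor

section ForwardBackwardForward

variable [CompleteSpace E] {c r : ℝ} {x y w p : E}

theorem StronglyConvexSq.lyapunov_forwardBackwardForward_le (hc : StronglyConvexSq E c)
    (hc₀ : 0 < c) {Ax Ay v : StrongDual ℝ E} (hr : 0 ≤ r)
    (hy : dualityMap x - r • Ax = dualityMap y + r • v)
    (hw : dualityMap w = dualityMap y - r • (Ay - Ax)) (hp : 0 ≤ (Ay + v) (y - p)) :
    lyapunov p w ≤ lyapunov p x - lyapunov y x +
      2 * uniformSmoothnessConst (StrongDual ℝ E) ^ 2 * (r * ‖Ay - Ax‖) ^ 2 := by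
  have hsmooth := hc.norm_add_sq_le_uniformSmoothnessConst hc₀ (dualityMap_mem y)
    (-(r • (Ay - Ax)))
  rw [← sub_eq_add_neg, ← hw, norm_dualityMap, norm_dualityMap, norm_neg, norm_smul,
    Real.norm_of_nonneg hr] at hsmooth
  have hx : dualityMap x = dualityMap y + r • v + r • Ax := by rw [← hy]; abel
  have hrp := mul_nonneg hr hp
  have hyy := dualityMap_self y
  simp only [lyapunov, hw, hx]
  simp only [add_apply, sub_apply, neg_apply, smul_apply, smul_eq_mul, map_sub] at hsmooth hrp ⊢
  linarith

theorem StronglyConvexSq.lyapunov_forwardBackwardForward_le_sub (hc : StronglyConvexSq E c)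
    (hc₀ : 0 < c) {A : E → StrongDual ℝ E} {v : StrongDual ℝ E} {L b θ : ℝ}
    (hA_lip : ‖A y - A x‖ ≤ L * ‖y - x‖) (hr : 0 ≤ r) (hrb : r ≤ b)
    (hθ : 2 * uniformSmoothnessConst (StrongDual ℝ E) ^ 2 * (b * L) ^ 2 ≤ (1 - θ) * c)
    (hy : dualityMap x - r • A x = dualityMap y + r • v)
    (hw : dualityMap w = dualityMap y - r • (A y - A x)) (hp : 0 ≤ (A y + v) (y - p)) :
    lyapunov p w ≤ lyapunov p x - θ * lyapunov y x := by
  have hθ₁ : 0 ≤ 1 - θ := nonneg_of_mul_nonneg_left (le_trans (by positivity) hθ) hc₀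
  have hrA : r * ‖A y - A x‖ ≤ b * L * ‖y - x‖ := by
    rw [mul_assoc]
    exact mul_le_mul hrb hA_lip (norm_nonneg _) (hr.trans hrb)
  have herror : 2 * uniformSmoothnessConst (StrongDual ℝ E) ^ 2 * (r * ‖A y - A x‖) ^ 2 ≤
      (1 - θ) * lyapunov y x :=
    calc 2 * uniformSmoothnessConst (StrongDual ℝ E) ^ 2 * (r * ‖A y - A x‖) ^ 2
        ≤ 2 * uniformSmoothnessConst (StrongDual ℝ E) ^ 2 * (b * L * ‖y - x‖) ^ 2 := by gcongr
      _ = 2 * uniformSmoothnessConst (StrongDual ℝ E) ^ 2 * (b * L) ^ 2 * ‖y - x‖ ^ 2 := by ring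
      _ ≤ (1 - θ) * c * ‖y - x‖ ^ 2 := by gcongr
      _ = (1 - θ) * (c * ‖y - x‖ ^ 2) := mul_assoc _ _ _
      _ ≤ (1 - θ) * lyapunov y x := by gcongr; exact hc.mul_norm_sub_sq_le_lyapunov y x
  linarith [hc.lyapunov_forwardBackwardForward_le hc₀ hr hy hw hp]

end ForwardBackwardForward

section GeneralizedProjection

variable {C : Set E} {x z : E}

theorem StronglyConvexSq.exists_isGeneralizedProjection_iff_eq [CompleteSpace E] {c : ℝ}
    (hc : StronglyConvexSq E c) (hc₀ : 0 < c) (hne : C.Nonempty) (hcl : IsClosed C)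
    (hcv : Convex ℝ C) (x : E) : ∃ z, ∀ z', IsGeneralizedProjection C x z' ↔ z' = z := by
  obtain ⟨z, hz, hmin⟩ := hc.exists_minimizer hc₀ hne hcl hcv (dualityMap x)
  have hmin' (y : E) (hy : y ∈ C) : lyapunov z x + c / 2 * ‖z - y‖ ^ 2 ≤ lyapunov y x := by
    simp only [lyapunov]
    linarith [hmin y hy]
  refine ⟨z, fun z' => ⟨fun h => ?_, ?_⟩⟩
  · have hdist : c / 2 * ‖z - z'‖ ^ 2 ≤ 0 := by linarith [h.2 z hz, hmin' z' h.1]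
    have hzero := (nonpos_of_mul_nonpos_right hdist (half_pos hc₀)).antisymm (sq_nonneg _)
    exact (sub_eq_zero.mp (norm_eq_zero.mp (pow_eq_zero_iff two_ne_zero |>.mp hzero))).symm
  · rintro rfl
    exact ⟨hz, fun y hy => (le_add_of_nonneg_right (by positivity)).trans (hmin' y hy)⟩

theorem IsGeneralizedProjection.sub_apply_nonpos (h : IsGeneralizedProjection C x z)
    (hE : UniformlySmooth E) (hcv : Convex ℝ C) {u : E} (hu : u ∈ C) :
    (dualityMap x - dualityMap z) (u - z) ≤ 0 := by
  have hsegment (t : ℝ) (ht : t ∈ Set.Ioo (0 : ℝ) 1) :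
      (dualityMap x - dualityMap z) (u - z) ≤
        (dualityMap (z + t • (u - z)) - dualityMap z) (u - z) := by
    have hmin := h.2 _ (hcv.add_smul_sub_mem h.1 hu ⟨ht.1.le, ht.2.le⟩)
    have hsub := subgradient_of_mem_dualitySet (dualityMap_mem (z + t • (u - z))) (-(t • (u - z)))
    rw [add_neg_cancel_right, map_neg, map_smul, smul_eq_mul] at hsub
    simp only [lyapunov, map_add (dualityMap x), map_smul, smul_eq_mul] at hmin
    rw [sub_apply, sub_apply]
    refine sub_le_sub_right (le_of_mul_le_mul_left ?_ ht.1) _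
    linarith
  have hlim : Tendsto (fun t : ℝ => z + t • (u - z) - z) (𝓝[>] 0) (𝓝 0) := by
    have : Continuous fun t : ℝ => z + t • (u - z) - z := by fun_prop
    simpa using (this.tendsto 0).mono_left (nhdsWithin_le_nhds (s := Set.Ioi 0))
  have hJ := hE.tendsto_dualityMap_sub (x := fun _ => z) (Eventually.of_forall fun _ => le_rfl) hlim
  have hJu : Tendsto (fun t : ℝ => (dualityMap (z + t • (u - z)) - dualityMap z) (u - z)) (𝓝[>] 0)
      (𝓝 0) :=
    (ContinuousLinearMap.apply ℝ ℝ (u - z)).map_zero ▸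
      ((ContinuousLinearMap.apply ℝ ℝ (u - z)).continuous.tendsto 0).comp hJ
  refine ge_of_tendsto hJu ?_
  filter_upwards [Ioo_mem_nhdsGT (zero_lt_one (α := ℝ))] using hsegment

end GeneralizedProjection

end Lyapunov

section Sequences

variable {s α β : ℕ → ℝ}

theorem tendsto_zero_of_le_one_sub_mul (hs : ∀ n, 0 ≤ s n)
    (hα_sum : Tendsto (fun N : ℕ => ∑ n ∈ Finset.Icc 1 N, α n) atTop atTop)
    (h : ∀ᶠ n in atTop, s (n + 1) ≤ (1 - α n) * s n) : Tendsto s atTop (𝓝 0) := by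
  obtain ⟨M, hM⟩ := eventually_atTop.mp h
  set T : ℕ → ℝ := fun N => ∑ n ∈ Finset.Icc 1 N, α n
  have hbound : ∀ n ≥ M, s (n + 1) ≤ s (M + 1) * Real.exp (T M) * Real.exp (-T n) := by
    intro n hn
    induction n, hn using Nat.le_induction with
    | base => rw [mul_assoc, ← Real.exp_add, add_neg_cancel, Real.exp_zero, mul_one]
    | succ n hn ih =>
      have hT : -T (n + 1) = -α (n + 1) + -T n := by
        rw [show T (n + 1) = T n + α (n + 1) from Finset.sum_Icc_succ_top (Nat.le_add_left 1 n) _]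
        ring
      calc s (n + 1 + 1) ≤ (1 - α (n + 1)) * s (n + 1) := hM _ (hn.trans n.le_succ)
        _ ≤ Real.exp (-α (n + 1)) * s (n + 1) :=
            mul_le_mul_of_nonneg_right (Real.one_sub_le_exp_neg _) (hs _)
        _ ≤ Real.exp (-α (n + 1)) * (s (M + 1) * Real.exp (T M) * Real.exp (-T n)) := by gcongr
        _ = s (M + 1) * Real.exp (T M) * Real.exp (-T (n + 1)) := by
            rw [hT, Real.exp_add (-α (n + 1))]
            ring
  have hexp : Tendsto (fun n => s (M + 1) * Real.exp (T M) * Real.exp (-T n)) atTop (𝓝 0) := by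
    simpa using (Real.tendsto_exp_neg_atTop_nhds_zero.comp hα_sum).const_mul
      (s (M + 1) * Real.exp (T M))
  exact (tendsto_add_atTop_iff_nat 1).mp (squeeze_zero' (Eventually.of_forall fun _ => hs _)
    (eventually_atTop.mpr ⟨M, hbound⟩) hexp)

/-- Xu's lemma. The excess `max (s n - ε) 0` satisfies the same recursion without `β`. -/
theorem tendsto_zero_of_le_one_sub_mul_add_mul (hs : ∀ n, 0 ≤ s n)
    (hα : ∀ᶠ n in atTop, 0 ≤ α n ∧ α n ≤ 1)
    (hα_sum : Tendsto (fun N : ℕ => ∑ n ∈ Finset.Icc 1 N, α n) atTop atTop)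
    (hβ : ∀ ε > 0, ∀ᶠ n in atTop, β n ≤ ε)
    (h : ∀ᶠ n in atTop, s (n + 1) ≤ (1 - α n) * s n + α n * β n) : Tendsto s atTop (𝓝 0) := by
  have hexcess (ε : ℝ) (hε : 0 < ε) : Tendsto (fun n => max (s n - ε) 0) atTop (𝓝 0) := by
    refine tendsto_zero_of_le_one_sub_mul (fun n => le_max_right _ _) hα_sum ?_
    filter_upwards [hα, hβ ε hε, h] with n ⟨hα₀, hα₁⟩ hβn hn
    refine max_le ?_ (mul_nonneg (sub_nonneg.mpr hα₁) (le_max_right _ _))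
    calc s (n + 1) - ε ≤ (1 - α n) * (s n - ε) := by
          linarith [mul_le_mul_of_nonneg_left hβn hα₀]
      _ ≤ (1 - α n) * max (s n - ε) 0 :=
          mul_le_mul_of_nonneg_left (le_max_left _ _) (sub_nonneg.mpr hα₁)
  refine tendsto_order.mpr ⟨fun ε hε => Eventually.of_forall fun n => hε.trans_le (hs n),
    fun ε hε => ?_⟩
  filter_upwards [(hexcess (ε / 2) (half_pos hε)).eventually_lt_const (half_pos hε)] with n hn
  linarith [le_max_left (s n - ε / 2) 0]

end Sequences

section Iteration

variable {E : Type*} [NormedAddCommGroup E] [NormedSpace ℝ E]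

/-- The Halpern-type forward-backward-forward iteration, written through the duality mapping alone.
The backward step `y n = J_{λ n}^B J⁻¹ (J (x n) - λ n • A (x n))` is recorded by an element `v n` of
`B (y n)`. As in the paper the iteration starts at the index `1`. -/
structure IsHalpernTseng (A : E → StrongDual ℝ E) (B : E → Set (StrongDual ℝ E)) (lam α : ℕ → ℝ)
    (x y w : ℕ → E) (v : ℕ → StrongDual ℝ E) : Prop where
  mem : ∀ n, 1 ≤ n → v n ∈ B (y n)
  backward : ∀ n, 1 ≤ n →
    dualityMap (x n) - lam n • A (x n) = dualityMap (y n) + lam n • v n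
  forward : ∀ n, 1 ≤ n → dualityMap (w n) = dualityMap (y n) - lam n • (A (y n) - A (x n))
  anchor : ∀ n, 1 ≤ n →
    dualityMap (x (n + 1)) = α n • dualityMap (x 1) + (1 - α n) • dualityMap (w n)

variable {A : E → StrongDual ℝ E} {B : E → Set (StrongDual ℝ E)} {lam α : ℕ → ℝ}
  {x y w : ℕ → E} {v : ℕ → StrongDual ℝ E} {a b c L R θ : ℝ} {z : E}

theorem IsMaximalMonotone.exists_isHalpernTseng (hB : IsMaximalMonotone B) (hE : UniformlySmooth E)
    (hrefl : Function.Surjective (NormedSpace.inclusionInDoubleDual ℝ E))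
    (hlam : ∀ n, 1 ≤ n → 0 < lam n)
    (hy : ∀ n, 1 ≤ n →
      y n = resolvent B (lam n) (dualityInv (dualityMap (x n) - lam n • A (x n))))
    (hw : ∀ n, 1 ≤ n → w n = dualityInv (dualityMap (y n) - lam n • (A (y n) - A (x n))))
    (hx : ∀ n, 1 ≤ n →
      x (n + 1) = dualityInv (α n • dualityMap (x 1) + (1 - α n) • dualityMap (w n))) :
    ∃ v, IsHalpernTseng A B lam α x y w v := by
  have hinv := hE.dualityMap_dualityInv hrefl
  have hres (n : ℕ) (hn : 1 ≤ n) : ∃ v ∈ B (y n),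
      dualityMap (x n) - lam n • A (x n) = dualityMap (y n) + lam n • v := by
    have h := hB.dualityMap_eq_dualityMap_resolvent_add hE hrefl (hlam n hn)
      (dualityInv (dualityMap (x n) - lam n • A (x n)))
    rwa [← hy n hn, hinv] at h
  choose! v hv hres using hres
  exact ⟨v, hv, hres, fun n hn => by rw [hw n hn, hinv], fun n hn => by rw [hx n hn, hinv]⟩

section Estimates

theorem IsHalpernTseng.lyapunov_le_sub [CompleteSpace E] (h : IsHalpernTseng A B lam α x y w v)
    (hc : StronglyConvexSq E c) (hc₀ : 0 < c)
    (hA_mono : ∀ x y : E, 0 ≤ (A x - A y) (x - y))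
    (hA_lip : ∀ x y : E, ‖A x - A y‖ ≤ L * ‖x - y‖) (hB : IsMonotoneOperator B)
    (hlam : ∀ n, 1 ≤ n → 0 ≤ lam n ∧ lam n ≤ b)
    (hθ : 2 * uniformSmoothnessConst (StrongDual ℝ E) ^ 2 * (b * L) ^ 2 ≤ (1 - θ) * c)
    (hz : z ∈ solutionSet A B) (n : ℕ) (hn : 1 ≤ n) :
    lyapunov z (w n) ≤ lyapunov z (x n) - θ * lyapunov (y n) (x n) :=
  hc.lyapunov_forwardBackwardForward_le_sub hc₀ (hA_lip _ _) (hlam n hn).1 (hlam n hn).2 hθ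
    (h.backward n hn) (h.forward n hn)
    (add_apply_sub_nonneg_of_mem_solutionSet hA_mono hB hz (h.mem n hn))

theorem IsHalpernTseng.lyapunov_le (h : IsHalpernTseng A B lam α x y w v)
    (hα : ∀ n, 1 ≤ n → 0 < α n ∧ α n < 1)
    (hstep : ∀ n, 1 ≤ n → lyapunov z (w n) ≤ lyapunov z (x n)) (n : ℕ) (hn : 1 ≤ n) :
    lyapunov z (x n) ≤ lyapunov z (x 1) := by
  induction n, hn using Nat.le_induction with
  | base => exact le_rfl
  | succ n hn ih =>
    obtain ⟨hα₀, hα₁⟩ := hα n hn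
    calc lyapunov z (x (n + 1)) ≤ α n * lyapunov z (x 1) + (1 - α n) * lyapunov z (w n) :=
          lyapunov_le_of_dualityMap_eq hα₀.le hα₁.le (h.anchor n hn) z
      _ ≤ α n * lyapunov z (x 1) + (1 - α n) * lyapunov z (x 1) := by
          gcongr
          exact (hstep n hn).trans ih
      _ = lyapunov z (x 1) := by ring

theorem IsHalpernTseng.exists_norm_le (h : IsHalpernTseng A B lam α x y w v)
    (hc : StronglyConvexSq E c) (hc₀ : 0 < c) (hα : ∀ n, 1 ≤ n → 0 < α n ∧ α n < 1) (hθ : 0 < θ)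
    (hstep : ∀ n, 1 ≤ n → lyapunov z (w n) ≤ lyapunov z (x n) - θ * lyapunov (y n) (x n)) :
    ∃ R, ∀ n, 1 ≤ n → ‖x n‖ ≤ R ∧ ‖y n‖ ≤ R := by
  set M := lyapunov z (x 1)
  have hM (n : ℕ) (hn : 1 ≤ n) : lyapunov z (x n) ≤ M :=
    h.lyapunov_le hα (fun n hn => (hstep n hn).trans
      (sub_le_self _ (mul_nonneg hθ.le (lyapunov_nonneg _ _)))) n hn
  refine ⟨‖z‖ + √(M / c) + √(M / θ / c), fun n hn => ?_⟩
  have hzx : ‖z - x n‖ ≤ √(M / c) :=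
    (hc.norm_sub_le_sqrt_lyapunov hc₀ _ _).trans (by gcongr; exact hM n hn)
  have hyx : ‖y n - x n‖ ≤ √(M / θ / c) := by
    refine (hc.norm_sub_le_sqrt_lyapunov hc₀ _ _).trans ?_
    gcongr
    rw [le_div_iff₀' hθ]
    linarith [hstep n hn, hM n hn, lyapunov_nonneg z (w n)]
  have hx := norm_sub_norm_le (x n) z
  rw [norm_sub_rev] at hx
  have hy := norm_sub_norm_le (y n) (x n)
  have hnonneg := Real.sqrt_nonneg (M / θ / c)
  exact ⟨by linarith, by linarith⟩

/-- The forcing term `β n` in the recursion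
`φ(z, x (n + 1)) ≤ (1 - α n) φ(z, x n) + α n β n`. It combines the anchoring error with the decrease
`θ φ(y n, x n)` gained in the forward-backward-forward step. -/
noncomputable def halpernForcing (θ : ℝ) (α : ℕ → ℝ) (x y : ℕ → E) (z : E) (n : ℕ) : ℝ :=
  2 * (dualityMap (x 1) - dualityMap z) (x (n + 1) - z) -
    (1 - α n) * θ * lyapunov (y n) (x n) / α n

theorem IsHalpernTseng.lyapunov_succ_le (h : IsHalpernTseng A B lam α x y w v) {n : ℕ} (hn : 1 ≤ n)
    (hα₀ : 0 < α n) (hα₁ : α n ≤ 1)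
    (hstep : lyapunov z (w n) ≤ lyapunov z (x n) - θ * lyapunov (y n) (x n)) :
    lyapunov z (x (n + 1)) ≤
      (1 - α n) * lyapunov z (x n) + α n * halpernForcing θ α x y z n := by
  have hforcing : α n * halpernForcing θ α x y z n =
      α n * (2 * (dualityMap (x 1) - dualityMap z) (x (n + 1) - z)) -
        (1 - α n) * θ * lyapunov (y n) (x n) := by
    rw [halpernForcing, mul_sub, mul_div_cancel₀ _ hα₀.ne']
  linarith [lyapunov_le_mul_add_of_dualityMap_eq hα₀.le hα₁ (h.anchor n hn) z,
    mul_le_mul_of_nonneg_left hstep (sub_nonneg.mpr hα₁)]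

theorem IsHalpernTseng.norm_add_le (h : IsHalpernTseng A B lam α x y w v) {n : ℕ} (hn : 1 ≤ n)
    (hlam : 0 < lam n) :
    ‖A (y n) + v n‖ ≤
      (lam n)⁻¹ * ‖dualityMap (y n) - dualityMap (x n)‖ + ‖A (y n) - A (x n)‖ := by
  have hJ : dualityMap (x n) - dualityMap (y n) = lam n • (v n + A (x n)) := by
    rw [eq_add_of_sub_eq (h.backward n hn), smul_add]
    abel
  have hAv : A (y n) + v n =
      (lam n)⁻¹ • (dualityMap (x n) - dualityMap (y n)) + (A (y n) - A (x n)) := by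
    rw [hJ, inv_smul_smul₀ hlam.ne']
    abel
  rw [hAv, norm_sub_rev (dualityMap (y n))]
  refine (_root_.norm_add_le _ _).trans_eq ?_
  rw [norm_smul, Real.norm_of_nonneg (inv_nonneg.mpr hlam.le)]

theorem IsHalpernTseng.mul_norm_sub_le (h : IsHalpernTseng A B lam α x y w v)
    (hc : StronglyConvexSq E c) {n : ℕ} (hn : 1 ≤ n) (hlam : 0 ≤ lam n) (hα₀ : 0 ≤ α n)
    (hα₁ : α n ≤ 1) :
    c * ‖x (n + 1) - y n‖ ≤ α n * (‖x 1‖ + ‖y n‖) + lam n * ‖A (y n) - A (x n)‖ := by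
  have hJ : dualityMap (x (n + 1)) - dualityMap (y n) =
      α n • (dualityMap (x 1) - dualityMap (y n)) -
        ((1 - α n) * lam n) • (A (y n) - A (x n)) := by
    rw [h.anchor n hn, h.forward n hn]
    module
  calc c * ‖x (n + 1) - y n‖ ≤ ‖dualityMap (x (n + 1)) - dualityMap (y n)‖ :=
        hc.mul_norm_sub_le (dualityMap_mem _) (dualityMap_mem _)
    _ ≤ α n * ‖dualityMap (x 1) - dualityMap (y n)‖ +
          (1 - α n) * lam n * ‖A (y n) - A (x n)‖ := by
        rw [hJ]
        refine (norm_sub_le _ _).trans_eq ?_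
        rw [norm_smul, norm_smul, Real.norm_of_nonneg hα₀,
          Real.norm_of_nonneg (mul_nonneg (sub_nonneg.mpr hα₁) hlam)]
    _ ≤ α n * (‖x 1‖ + ‖y n‖) + lam n * ‖A (y n) - A (x n)‖ := by
        gcongr
        · exact (norm_sub_le _ _).trans_eq (by rw [norm_dualityMap, norm_dualityMap])
        · exact mul_le_of_le_one_left hlam (sub_le_self _ hα₀)

end Estimates

section Limits

theorem exists_ultrafilter_of_frequently {ι : Type*} {l : Filter ι} {p : ι → Prop}
    (h : ∃ᶠ i in l, p i) :
    ∃ U : Ultrafilter ι, (U : Filter ι) ≤ l ∧ ∀ᶠ i in (U : Filter ι), p i := by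
  have : (l ⊓ 𝓟 {i | p i}).NeBot := frequently_mem_iff_neBot.mp h
  obtain ⟨U, hU⟩ := exists_ultrafilter_le (l ⊓ 𝓟 {i | p i})
  exact ⟨U, hU.trans inf_le_left, le_principal_iff.mp (hU.trans inf_le_right)⟩

variable {l : Filter ℕ}

theorem tendsto_lyapunov_of_halpernForcing_nonneg (hθ : 0 < θ)
    (hα : ∀ᶠ n in l, 0 < α n ∧ α n < 1) (hα_lim : Tendsto α l (𝓝 0))
    (hR : ∀ᶠ n in l, ‖x (n + 1)‖ ≤ R) (hforcing : ∀ᶠ n in l, 0 ≤ halpernForcing θ α x y z n) :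
    Tendsto (fun n => lyapunov (y n) (x n)) l (𝓝 0) := by
  set g := dualityMap (x 1) - dualityMap z
  have hlim : Tendsto (fun n => α n * (2 * (‖g‖ * (R + ‖z‖))) / ((1 - α n) * θ)) l (𝓝 0) := by
    have := (hα_lim.mul_const (2 * (‖g‖ * (R + ‖z‖)))).div
      ((hα_lim.const_sub 1).mul_const θ) (by simpa using hθ.ne')
    rwa [zero_mul, zero_div] at this
  refine squeeze_zero' (Eventually.of_forall fun n => lyapunov_nonneg _ _) ?_ hlim
  filter_upwards [hα, hR, hforcing] with n ⟨hα₀, hα₁⟩ hn hβ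
  have hg : g (x (n + 1) - z) ≤ ‖g‖ * (R + ‖z‖) :=
    (apply_le_norm_mul_norm _ _).trans (by gcongr; exact norm_sub_le_of_le hn le_rfl)
  rw [halpernForcing, sub_nonneg, div_le_iff₀ hα₀] at hβ
  rw [le_div_iff₀ (mul_pos (sub_pos.mpr hα₁) hθ)]
  linarith [mul_le_mul_of_nonneg_left hg hα₀.le]

theorem tendsto_sub_of_lipschitz {ι : Type*} {l : Filter ι} {u u' : ι → E}
    (hA_lip : ∀ x y : E, ‖A x - A y‖ ≤ L * ‖x - y‖)
    (h : Tendsto (fun i => u i - u' i) l (𝓝 0)) : Tendsto (fun i => A (u i) - A (u' i)) l (𝓝 0) :=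
  squeeze_zero_norm (fun _ => hA_lip _ _) (by simpa using h.norm.const_mul L)

theorem IsHalpernTseng.tendsto_add (h : IsHalpernTseng A B lam α x y w v) (hE : UniformlySmooth E)
    (hA_lip : ∀ x y : E, ‖A x - A y‖ ≤ L * ‖x - y‖) (hl : ∀ᶠ n in l, 1 ≤ n) (ha : 0 < a)
    (hlam : ∀ n, 1 ≤ n → a ≤ lam n) (hR : ∀ᶠ n in l, ‖x n‖ ≤ R)
    (hyx : Tendsto (fun n => y n - x n) l (𝓝 0)) :
    Tendsto (fun n => A (y n) + v n) l (𝓝 0) := by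
  have hbound := ((hE.tendsto_dualityMap_sub hR hyx).norm.const_mul a⁻¹).add
    (tendsto_sub_of_lipschitz hA_lip hyx).norm
  rw [norm_zero, mul_zero, add_zero] at hbound
  refine squeeze_zero_norm' (hl.mono fun n hn => ?_) hbound
  refine (h.norm_add_le hn (ha.trans_le (hlam n hn))).trans ?_
  gcongr
  exact hlam n hn

theorem IsHalpernTseng.tendsto_succ_sub (h : IsHalpernTseng A B lam α x y w v)
    (hc : StronglyConvexSq E c) (hc₀ : 0 < c)
    (hA_lip : ∀ x y : E, ‖A x - A y‖ ≤ L * ‖x - y‖) (hl : ∀ᶠ n in l, 1 ≤ n)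
    (hlam : ∀ n, 1 ≤ n → 0 ≤ lam n ∧ lam n ≤ b) (hα : ∀ n, 1 ≤ n → 0 < α n ∧ α n < 1)
    (hα_lim : Tendsto α l (𝓝 0)) (hR : ∀ᶠ n in l, ‖y n‖ ≤ R)
    (hyx : Tendsto (fun n => y n - x n) l (𝓝 0)) :
    Tendsto (fun n => x (n + 1) - y n) l (𝓝 0) := by
  have hbound := ((hα_lim.mul_const (‖x 1‖ + R)).add
    ((tendsto_sub_of_lipschitz hA_lip hyx).norm.const_mul b)).div_const c
  rw [zero_mul, norm_zero, mul_zero, add_zero, zero_div] at hbound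
  refine squeeze_zero_norm' ?_ hbound
  filter_upwards [hl, hR] with n hn hyR
  obtain ⟨hα₀, hα₁⟩ := hα n hn
  rw [le_div_iff₀' hc₀]
  refine (h.mul_norm_sub_le hc hn (hlam n hn).1 hα₀.le hα₁.le).trans ?_
  gcongr
  exact (hlam n hn).2

theorem add_apply_sub_nonneg_of_tendsto_weak (hA_mono : ∀ x y : E, 0 ≤ (A x - A y) (x - y))
    (hB : IsMonotoneOperator B) {ι : Type*} {l : Filter ι} [l.NeBot] {y : ι → E}
    {v : ι → StrongDual ℝ E} {p : E} (hR : ∀ᶠ i in l, ‖y i‖ ≤ R) (hv : ∀ᶠ i in l, v i ∈ B (y i))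
    (hlim : Tendsto (fun i => A (y i) + v i) l (𝓝 0))
    (hp : ∀ f : StrongDual ℝ E, Tendsto (fun i => f (y i)) l (𝓝 (f p)))
    (u : E) (g : StrongDual ℝ E) (hg : g ∈ B u) : 0 ≤ (A u + g) (u - p) := by
  have hweak : Tendsto (fun i => (A u + g) (u - y i)) l (𝓝 ((A u + g) (u - p))) := by
    simpa only [map_sub] using (hp (A u + g)).const_sub ((A u + g) u)
  have hsmall : Tendsto (fun i => (A (y i) + v i) (u - y i)) l (𝓝 0) := by
    have hnorm := hlim.norm.mul_const (‖u‖ + R)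
    rw [norm_zero, zero_mul] at hnorm
    refine squeeze_zero_norm' (hR.mono fun i hi => ?_) hnorm
    exact ((A (y i) + v i).le_opNorm _).trans (by gcongr; exact norm_sub_le_of_le le_rfl hi)
  refine le_of_tendsto_of_tendsto hsmall hweak (hv.mono fun i hi => ?_)
  have hA := hA_mono u (y i)
  have hB' := hB u (y i) g hg _ hi
  simp only [add_apply, sub_apply] at hA hB' ⊢
  linarith

end Limits

section Convergence

variable [CompleteSpace E]

theorem IsHalpernTseng.exists_mem_solutionSet_tendsto_weak
    (h : IsHalpernTseng A B lam α x y w v) (hc : StronglyConvexSq E c) (hc₀ : 0 < c)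
    (hE : UniformlySmooth E) (hL : 0 < L) (hA_mono : ∀ x y : E, 0 ≤ (A x - A y) (x - y))
    (hA_lip : ∀ x y : E, ‖A x - A y‖ ≤ L * ‖x - y‖) (hB : IsMaximalMonotone B) (ha : 0 < a)
    (hlam : ∀ n, 1 ≤ n → a ≤ lam n) (hR : ∀ n, 1 ≤ n → ‖x n‖ ≤ R ∧ ‖y n‖ ≤ R)
    (U : Ultrafilter ℕ) (hU : ∀ᶠ n in (U : Filter ℕ), 1 ≤ n)
    (hyx : Tendsto (fun n => y n - x n) U (𝓝 0)) :
    ∃ p ∈ solutionSet A B, ∀ f : StrongDual ℝ E, Tendsto (fun n => f (y n)) U (𝓝 (f p)) := by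
  have hrefl := hc.surjective_inclusionInDoubleDual hc₀
  have hyR : ∀ᶠ n in (U : Filter ℕ), ‖y n‖ ≤ R := hU.mono fun n hn => (hR n hn).2
  obtain ⟨p, hp⟩ := exists_weak_limit hrefl U hyR
  refine ⟨p, (mem_solutionSet_iff hrefl hL hA_mono hA_lip hB).mpr ?_, hp⟩
  exact add_apply_sub_nonneg_of_tendsto_weak hA_mono hB.1 hyR (hU.mono h.mem)
    (h.tendsto_add hE hA_lip hU ha hlam (hU.mono fun n hn => (hR n hn).1) hyx) hp

theorem IsHalpernTseng.eventually_halpernForcing_le (h : IsHalpernTseng A B lam α x y w v)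
    (hc : StronglyConvexSq E c) (hc₀ : 0 < c) (hE : UniformlySmooth E) (hL : 0 < L)
    (hA_mono : ∀ x y : E, 0 ≤ (A x - A y) (x - y))
    (hA_lip : ∀ x y : E, ‖A x - A y‖ ≤ L * ‖x - y‖) (hB : IsMaximalMonotone B) (ha : 0 < a)
    (hlam : ∀ n, 1 ≤ n → a ≤ lam n ∧ lam n ≤ b) (hα : ∀ n, 1 ≤ n → 0 < α n ∧ α n < 1)
    (hα_lim : Tendsto α atTop (𝓝 0)) (hR : ∀ n, 1 ≤ n → ‖x n‖ ≤ R ∧ ‖y n‖ ≤ R) (hθ : 0 < θ)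
    (hvar : ∀ p ∈ solutionSet A B, (dualityMap (x 1) - dualityMap z) (p - z) ≤ 0) {ε : ℝ}
    (hε : 0 < ε) : ∀ᶠ n in atTop, halpernForcing θ α x y z n ≤ ε := by
  by_contra hcon
  obtain ⟨U, hUtop, hUε⟩ := exists_ultrafilter_of_frequently (not_eventually.mp hcon)
  simp only [not_le] at hUε
  have hU : ∀ᶠ n in (U : Filter ℕ), 1 ≤ n := hUtop (eventually_ge_atTop 1)
  have hφ : Tendsto (fun n => lyapunov (y n) (x n)) U (𝓝 0) :=
    tendsto_lyapunov_of_halpernForcing_nonneg hθ (hU.mono hα) (hα_lim.mono_left hUtop)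
      (Eventually.of_forall fun n => (hR (n + 1) (Nat.le_add_left 1 n)).1)
      (hUε.mono fun n hn => (hε.trans hn).le)
  have hyx := hc.tendsto_sub_of_tendsto_lyapunov hc₀ hφ
  have hxy := h.tendsto_succ_sub hc hc₀ hA_lip hU
    (fun n hn => ⟨ha.le.trans (hlam n hn).1, (hlam n hn).2⟩) hα (hα_lim.mono_left hUtop)
    (hU.mono fun n hn => (hR n hn).2) hyx
  obtain ⟨p, hpS, hp⟩ := h.exists_mem_solutionSet_tendsto_weak hc hc₀ hE hL hA_mono hA_lip hB ha
    (fun n hn => (hlam n hn).1) hR U hU hyx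
  set g := dualityMap (x 1) - dualityMap z
  have hanchor : Tendsto (fun n => 2 * g (x (n + 1) - z)) U (𝓝 (2 * g (p - z))) := by
    have hsum := (((g.continuous.tendsto 0).comp hxy).add (hp g)).sub_const (g z)
    rw [map_zero, zero_add, ← map_sub] at hsum
    refine (hsum.const_mul 2).congr fun n => ?_
    simp only [Function.comp_apply, ← map_add, ← map_sub, sub_add_cancel]
  have hle : ε ≤ 2 * g (p - z) := by
    refine ge_of_tendsto hanchor ?_
    filter_upwards [hU, hUε] with n hn hβ
    obtain ⟨hα₀, hα₁⟩ := hα n hn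
    have hdecrease : 0 ≤ (1 - α n) * θ * lyapunov (y n) (x n) / α n :=
      div_nonneg (mul_nonneg (mul_nonneg (sub_nonneg.mpr hα₁.le) hθ.le) (lyapunov_nonneg _ _))
        hα₀.le
    rw [halpernForcing] at hβ
    linarith
  linarith [hvar p hpS]

theorem IsHalpernTseng.tendsto_generalizedProjection (h : IsHalpernTseng A B lam α x y w v)
    (hc : StronglyConvexSq E c) (hc₀ : 0 < c) (hE : UniformlySmooth E) (hL : 0 < L)
    (hA_mono : ∀ x y : E, 0 ≤ (A x - A y) (x - y))
    (hA_lip : ∀ x y : E, ‖A x - A y‖ ≤ L * ‖x - y‖) (hB : IsMaximalMonotone B) (ha : 0 < a)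
    (hlam : ∀ n, 1 ≤ n → a ≤ lam n ∧ lam n ≤ b) (hθ : 0 < θ)
    (hθ_le : 2 * uniformSmoothnessConst (StrongDual ℝ E) ^ 2 * (b * L) ^ 2 ≤ (1 - θ) * c)
    (hα : ∀ n, 1 ≤ n → 0 < α n ∧ α n < 1) (hα_lim : Tendsto α atTop (𝓝 0))
    (hα_sum : Tendsto (fun N : ℕ => ∑ n ∈ Finset.Icc 1 N, α n) atTop atTop)
    (hz : IsGeneralizedProjection (solutionSet A B) (x 1) z) : Tendsto x atTop (𝓝 z) := by
  have hrefl := hc.surjective_inclusionInDoubleDual hc₀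
  have hstep := h.lyapunov_le_sub hc hc₀ hA_mono hA_lip hB.1
    (fun n hn => ⟨ha.le.trans (hlam n hn).1, (hlam n hn).2⟩) hθ_le hz.1
  obtain ⟨R, hR⟩ := h.exists_norm_le hc hc₀ hα hθ hstep
  have hforcing (ε : ℝ) (hε : 0 < ε) : ∀ᶠ n in atTop, halpernForcing θ α x y z n ≤ ε :=
    h.eventually_halpernForcing_le hc hc₀ hE hL hA_mono hA_lip hB ha hlam hα hα_lim hR hθ
      (fun p hp => hz.sub_apply_nonpos hE
        (convex_solutionSet hrefl hL hA_mono hA_lip hB) hp) hε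
  have hφ : Tendsto (fun n => lyapunov z (x n)) atTop (𝓝 0) := by
    refine tendsto_zero_of_le_one_sub_mul_add_mul (fun n => lyapunov_nonneg z (x n))
      ((eventually_ge_atTop 1).mono fun n hn => ⟨(hα n hn).1.le, (hα n hn).2.le⟩) hα_sum
      hforcing ?_
    exact (eventually_ge_atTop 1).mono fun n hn =>
      h.lyapunov_succ_le hn (hα n hn).1 (hα n hn).2.le (hstep n hn)
  have hzx := (hc.tendsto_sub_of_tendsto_lyapunov hc₀ hφ).const_sub z
  simpa only [sub_sub_cancel, sub_zero] using hzx

end Convergence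

end Iteration

end BanachTseng

theorem mainTheorem4 {E : Type*} [NormedAddCommGroup E] [NormedSpace ℝ E] [CompleteSpace E]
    (hconv : BanachTseng.TwoUniformlyConvex E) (hsmooth : BanachTseng.UniformlySmooth E)
    (A : E → StrongDual ℝ E) (B : E → Set (StrongDual ℝ E)) (L : ℝ) (hL : 0 < L)
    (hA_mono : ∀ x y : E, 0 ≤ (A x - A y) (x - y))
    (hA_lip : ∀ x y : E, ‖A x - A y‖ ≤ L * ‖x - y‖)
    (hB : BanachTseng.IsMaximalMonotone B)
    (hsol : (BanachTseng.solutionSet A B).Nonempty)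
    (lam : ℕ → ℝ) (a b : ℝ) (ha : 0 < a)
    (hlam : ∀ n : ℕ, 1 ≤ n → a ≤ lam n ∧ lam n ≤ b)
    -- `b < 1 / (√2 μ κ L)`, cleared of the denominator
    (hb : b * (Real.sqrt 2 * BanachTseng.uniformConvexityConst E *
      BanachTseng.uniformSmoothnessConst (StrongDual ℝ E) * L) < 1)
    (α : ℕ → ℝ) (hα : ∀ n : ℕ, 1 ≤ n → 0 < α n ∧ α n < 1)
    (hα_lim : Tendsto α atTop (𝓝 0))
    (hα_sum : Tendsto (fun N : ℕ => ∑ n ∈ Finset.Icc 1 N, α n) atTop atTop)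
    (x y w : ℕ → E)
    (hy : ∀ n : ℕ, 1 ≤ n → y n = BanachTseng.resolvent B (lam n)
      (BanachTseng.dualityInv (BanachTseng.dualityMap (x n) - lam n • A (x n))))
    (hw : ∀ n : ℕ, 1 ≤ n → w n = BanachTseng.dualityInv
      (BanachTseng.dualityMap (y n) - lam n • (A (y n) - A (x n))))
    (hx : ∀ n : ℕ, 1 ≤ n → x (n + 1) = BanachTseng.dualityInv
      (α n • BanachTseng.dualityMap (x 1) + (1 - α n) • BanachTseng.dualityMap (w n))) :
    ∃ z : E,
      (∀ z' : E, BanachTseng.IsGeneralizedProjection (BanachTseng.solutionSet A B) (x 1) z' ↔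
        z' = z) ∧
      Tendsto x atTop (𝓝 z) := by
  obtain ⟨hμ, hc⟩ := hconv.stronglyConvexSq
  set μ := BanachTseng.uniformConvexityConst E
  set κ := BanachTseng.uniformSmoothnessConst (StrongDual ℝ E)
  have hμ₀ : 0 < μ := zero_lt_one.trans_le hμ
  have hc₀ : 0 < μ⁻¹ ^ 2 := pow_pos (inv_pos.mpr hμ₀) 2
  have hκ : 0 ≤ κ := BanachTseng.uniformSmoothnessConst_nonneg _
  have hb₀ : 0 ≤ b := ha.le.trans ((hlam 1 le_rfl).1.trans (hlam 1 le_rfl).2)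
  set q := b * (Real.sqrt 2 * μ * κ * L)
  have hq : 0 < 1 - q ^ 2 := sub_pos.mpr (pow_lt_one₀ (by positivity) hb two_ne_zero)
  have hqc : 2 * κ ^ 2 * (b * L) ^ 2 = (1 - (1 - q ^ 2)) * μ⁻¹ ^ 2 := by
    simp only [q, mul_pow, Real.sq_sqrt zero_le_two]
    field_simp
    ring
  have hrefl := hc.surjective_inclusionInDoubleDual hc₀
  obtain ⟨z, hz⟩ := hc.exists_isGeneralizedProjection_iff_eq hc₀ hsol
    (BanachTseng.isClosed_solutionSet hrefl hL hA_mono hA_lip hB)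
    (BanachTseng.convex_solutionSet hrefl hL hA_mono hA_lip hB) (x 1)
  obtain ⟨v, h⟩ := hB.exists_isHalpernTseng hsmooth hrefl
    (fun n hn => ha.trans_le (hlam n hn).1) hy hw hx
  exact ⟨z, hz, h.tendsto_generalizedProjection hc hc₀ hsmooth hL hA_mono hA_lip hB ha hlam hq
    hqc.le hα hα_lim hα_sum ((hz z).mpr rfl)⟩
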